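/- Let $d\ge 1$, let $\Omega\subset\mathbb R^d$ be a bounded domain (open, connected, non-empty) with Lipschitz boundary $\Gamma$, let $\Gamma_N\subset\Gamma$ be relatively open and $\Gamma_D=\Gamma\setminus\Gamma_N$. All functions are complex valued; $(u,v)=\int_\Omega u\bar v$ and $\|\cdot\|$ are the inner product and norm of $L^2(\Omega)$, $\|v\|_1=(\|v\|^2+\|\nabla v\|^2)^{1/2}$ is the norm of $H^1(\Omega)$, and $\mathbb V=\{v\in H^1(\Omega): v=0 \text{ on } \Gamma_D \text{ in the sense of traces}\}$. Let $a_{i,j}:\Omega\to\mathbb C$, $0\le i,j\le d$, be coefficients such that $$A(u,v)=\int_\Omega\Big(\sum_{i,j=1}^d a_{i,j}\,\partial_iu\,\overline{\partial_jv}+\sum_{i=1}^d\big(a_{i,0}\,\partial_iu\,\overline v+a_{0,i}\,u\,\overline{\partial_iv}\big)+a_{0,0}\,u\,\overline v\Big)$$ is defined (the integrand is integrable) for all $u,v\in\mathbb V$. Assume that there are $c_0,c_1>0$ with $$\Re A(v,v)\ge c_0\|v\|_1^2,\qquad |A(u,v)|\le c_1\|u\|_1\|v\|_1\qquad\text{for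 all } u,v\in\mathbb V .$$ For a bounded coercive sesquilinear form $B(\cdot,\cdot)$ on $\mathbb V$, the operator $B$ on $L^2(\Omega)$ associated with the form is the inverse of the injective map $L^2(\Omega)\ni f\mapsto w\in\mathbb V$ given by $B(w,\phi)=(f,\phi)$ for all $\phi\in\mathbb V$; $D(B)$ is the range of this map. For $0<\beta<1$ let $B^{-\beta}f=\frac{\sin(\beta\pi)}{\pi}\int_0^\infty\mu^{-\beta}(\mu I+B)^{-1}f\,d\mu$, and let $B^0=I$. For $\beta\in[0,1]$ let $D(B^\beta)=\{u\in L^2(\Omega): B^{\beta-1}u\in D(B)\}$ and $B^\beta u=B(B^{\beta-1}u)$, with norm $\|u\|_{D(B^\beta)}=\|B^\beta u\|$. Let $A$, $A^*$ and $S$ be the operators associated with the forms $A(u,v)$, $\overline{A(v,u)}$ and $\frac12\big(A(u,v)+\overline{A(v,u)}\big)$. For $r\in[0,1)$ let $\dot H^r=D(S^{r/2})$ with norm $\|S^{r/2}\cdot\|$, and let $\dot H^{-r}_a$ (resp. $\dot H^{-r}_l$) be the space of antilinear (resp. linear) functionals on $\mathbb V$ that are bounded in the norm of $\dot H^r$,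 with the dual norm. For a bounded antilinear functional $F$ on $\mathbb V$ let $T_aF\in\mathbb V$ be the solution of $A(T_aF,\phi)=F(\phi)$ for all $\phi\in\mathbb V$; for a bounded linear functional $F$ on $\mathbb V$ let $T_l^*F\in\mathbb V$ be the solution of $A(\phi,T_l^*F)=F(\phi)$ for all $\phi\in\mathbb V$. For $1<s\le2$, $H^s(\Omega)$ is the Sobolev(-Slobodeckij) space, and $H^s(\Omega)\cap\mathbb V$ carries the norm of $H^s(\Omega)$. Assume elliptic regularity with index $\alpha\in(0,1]$: for every $t\in(0,\alpha]$, $T_a$ is a bounded map of $\dot H_a^{-1+t}$ into $H^{1+t}(\Omega)\cap\mathbb V$ and $T_l^*$ is a bounded map of $\dot H_l^{-1+t}$ into $H^{1+t}(\Omega)\cap\mathbb V$. Then, for every $s\in(1,1+\alpha]$, $$D(A^{s/2})\subset H^s(\Omega)\cap\mathbb V\qquad\text{and}\qquad D((A^*)^{s/2})\subset H^s(\Omega)\cap\mathbb V$$ with continuous embeddings. -/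

import Mathlib

open MeasureTheory
open scoped NNReal ENNReal ContDiff InnerProductSpace

noncomputable section

namespace RegAcc

/-! ### Operators associated with a sesquilinear form

`V` is the variational space, `H` the pivot Hilbert space, `j : V → H` the inclusion and
`a : V → V → ℂ` the form, linear in its first and antilinear in its second argument.
Mathlib's `⟪x, y⟫_ℂ` is antilinear in `x`, so the pairing `(x, y)` of the mathematical text
is `⟪y, x⟫_ℂ`. -/

section Abstract

variable {V H : Type*} [NormedAddCommGroup V] [InnerProductSpace ℂ V]
  [NormedAddCommGroup H] [InnerProductSpace ℂ H]

/-- The adjoint form `a*(u, v) = conj (a(v, u))`. -/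
def adjForm (a : V → V → ℂ) (u v : V) : ℂ := starRingEnd ℂ (a v u)

/-- The Hermitian part `(Re a)(u, v) = (a(u, v) + conj (a(v, u))) / 2`. -/
def reForm (a : V → V → ℂ) (u v : V) : ℂ := (a u v + starRingEnd ℂ (a v u)) / 2

/-- The (unique, when `a` is bounded and coercive and `F` is bounded and antilinear) solution
`p ∈ V` of `a(p, φ) = F(φ)` for all `φ ∈ V`. -/
def solveForm (a : V → V → ℂ) (F : V → ℂ) : V :=
  Classical.epsilon fun p : V => ∀ φ : V, a p φ = F φ

/-- The (unique, when `a` is bounded and coercive and `F` is bounded and linear) solution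
`q ∈ V` of `a(φ, q) = F(φ)` for all `φ ∈ V`. -/
def solveFormAdj (a : V → V → ℂ) (F : V → ℂ) : V :=
  Classical.epsilon fun q : V => ∀ φ : V, a φ q = F φ

/-- The resolvent `(μ + A)⁻¹ f`, for the operator `A` of the form `a`: the solution `p ∈ V` of
`a(p, φ) + μ (p, φ) = (f, φ)` for all `φ ∈ V`, seen in `H`. -/
def resolventOp (j : V →L[ℂ] H) (a : V → V → ℂ) (μ : ℝ) (f : H) : H :=
  j (solveForm (fun p φ => a p φ + (μ : ℂ) * ⟪j φ, j p⟫_ℂ) (fun φ => ⟪j φ, f⟫_ℂ))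

/-- The solution operator `f ↦ p`, `a(p, φ) = (f, φ)` for all `φ ∈ V`. The operator `A` of the
form is the inverse of this map; its domain is the range of this map. -/
def solOp (j : V →L[ℂ] H) (a : V → V → ℂ) (f : H) : H :=
  j (solveForm a (fun φ => ⟪j φ, f⟫_ℂ))

/-- The power `A ^ (-β)`, `β ∈ [0, 1]`: the identity for `β = 0`, the solution operator `A⁻¹` for
`β = 1`, and the Balakrishnan integral
`A ^ (-β) f = sin (β π) / π * ∫_0^∞ μ ^ (-β) (μ + A)⁻¹ f dμ` for `0 < β < 1`. -/
def negPow (j : V →L[ℂ] H) (a : V → V → ℂ) (β : ℝ) (f : H) : H :=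
  open Classical in
  if β = 0 then f
  else if β = 1 then solOp j a f
  else ((Real.sin (β * Real.pi) / Real.pi : ℝ) : ℂ) •
    ∫ μ in Set.Ioi (0 : ℝ), ((μ ^ (-β) : ℝ) : ℂ) • resolventOp j a μ f

/-- The graph of the power `A ^ β`, `β ∈ [0, 1]`: `IsPow j a β u w` says that `u ∈ D(A ^ β)` and
`A ^ β u = w`, that is, `A ^ (β - 1) u` lies in the domain of `A` and `A (A ^ (β - 1) u) = w`
(equivalently `A ^ (β - 1) u` is the image of `w` under the solution operator). -/
def IsPow (j : V →L[ℂ] H) (a : V → V → ℂ) (β : ℝ) (u w : H) : Prop :=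
  negPow j a (1 - β) u = solOp j a w

/-- `DotDualBound j a r F M` says that the functional `F` on `V` (linear or antilinear) is bounded
by `M` with respect to the norm `‖θ‖_{Ḣ^r} = ‖S ^ (r / 2) θ‖` of `Ḣ^r = D(S ^ (r / 2))`, where `S`
is the self-adjoint operator of the Hermitian part of `a`. For `r ∈ [0, 1)` the space `V` is
dense in `Ḣ^r`, so this says that `F` belongs to the dual `Ḣ^(-r)` of `Ḣ^r` with norm at most
`M`. -/
def DotDualBound (j : V →L[ℂ] H) (a : V → V → ℂ) (r : ℝ) (F : V → ℂ) (M : ℝ≥0) : Prop :=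
  ∀ (θ : V) (w : H), IsPow j (reForm a) (r / 2) (j θ) w → ‖F θ‖ ≤ M * ‖w‖

end Abstract

/-! ### Domains and Sobolev spaces -/

/-- Euclidean space `ℝ^d`. -/
abbrev E (d : ℕ) : Type := EuclideanSpace ℝ (Fin d)

/-- The complex space `L²(Ω)`. -/
abbrev L2 {d : ℕ} (Ω : Set (E d)) : Type := Lp ℂ 2 (volume.restrict Ω)

/-- `Ω` has a Lipschitz boundary: near every boundary point, in suitable orthogonal coordinates
(`e` being the vertical direction), `Ω` is the set of points above the graph of a Lipschitz
function. -/
def HasLipschitzBoundary {d : ℕ} (Ω : Set (E d)) : Prop :=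
  ∀ x ∈ frontier Ω, ∃ (e : E d) (r : ℝ) (K : ℝ≥0) (γ : (ℝ ∙ e)ᗮ → ℝ),
    ‖e‖ = 1 ∧ 0 < r ∧ LipschitzWith K γ ∧
      ∀ y ∈ Metric.ball x r,
        (y ∈ Ω ↔ γ ((ℝ ∙ e)ᗮ.orthogonalProjectionOnto y) < ⟪e, y⟫_ℝ)

/-- The partial derivative `∂_i φ` of a function on `ℝ^d`. -/
def partialD {d : ℕ} {F : Type*} [NormedAddCommGroup F] [NormedSpace ℝ F]
    (i : Fin d) (φ : E d → F) (x : E d) : F :=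
  fderiv ℝ φ x (EuclideanSpace.single i (1 : ℝ))

/-- `g` is the weak partial derivative `∂_i u` on `Ω`. -/
def HasWeakPartial {d : ℕ} (Ω : Set (E d)) (i : Fin d) (u g : L2 Ω) : Prop :=
  ∀ φ : E d → ℝ, ContDiff ℝ ∞ φ → HasCompactSupport φ → tsupport φ ⊆ Ω →
    ∫ x in Ω, partialD i φ x • u x = - ∫ x in Ω, φ x • g x

/-- The Hilbert sum of `d + 1` copies of `L²(Ω)`. -/
abbrev L2Tuple {d : ℕ} (Ω : Set (E d)) : Type := PiLp 2 fun _ : Fin (d + 1) => L2 Ω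

theorem integrable_smul_L2 {d : ℕ} {Ω : Set (E d)} {η : E d → ℝ} (hη : Continuous η)
    (hc : HasCompactSupport η) (f : L2 Ω) :
    Integrable (fun x => η x • f x) (volume.restrict Ω) := by
  have h1 : MemLp η 2 (volume.restrict Ω) := (hη.memLp_of_hasCompactSupport hc)
  have h2 : MemLp f 2 (volume.restrict Ω) := Lp.memLp f
  exact memLp_one_iff_integrable.1 (h2.smul h1)

theorem partialD_continuous {d : ℕ} {φ : E d → ℝ} (h : ContDiff ℝ ∞ φ) (i : Fin d) :
    Continuous (partialD i φ) :=
  (h.continuous_fderiv (by simp)).clm_apply continuous_const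

theorem partialD_compact {d : ℕ} {φ : E d → ℝ} (h : HasCompactSupport φ) (i : Fin d) :
    HasCompactSupport (partialD i φ) :=
  h.fderiv_apply (𝕜 := ℝ) _

theorem HasWeakPartial.add {d : ℕ} {Ω : Set (E d)} {i : Fin d} {u g u' g' : L2 Ω}
    (h : HasWeakPartial Ω i u g) (h' : HasWeakPartial Ω i u' g') :
    HasWeakPartial Ω i (u + u') (g + g') := by
  intro φ h1 h2 h3
  have A : ∫ x in Ω, partialD i φ x • (u + u') x
      = ∫ x in Ω, (partialD i φ x • u x + partialD i φ x • u' x) := by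
    refine integral_congr_ae ?_
    filter_upwards [Lp.coeFn_add u u'] with x hx
    rw [hx, Pi.add_apply, smul_add]
  have B : ∫ x in Ω, φ x • (g + g') x = ∫ x in Ω, (φ x • g x + φ x • g' x) := by
    refine integral_congr_ae ?_
    filter_upwards [Lp.coeFn_add g g'] with x hx
    rw [hx, Pi.add_apply, smul_add]
  have c1 := partialD_continuous h1 i
  have c2 := partialD_compact h2 i
  rw [A, B, integral_add (integrable_smul_L2 c1 c2 u) (integrable_smul_L2 c1 c2 u'),
    integral_add (integrable_smul_L2 h1.continuous h2 g) (integrable_smul_L2 h1.continuous h2 g'),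
    h φ h1 h2 h3, h' φ h1 h2 h3, neg_add]

theorem HasWeakPartial.smul {d : ℕ} {Ω : Set (E d)} {i : Fin d} {u g : L2 Ω}
    (c : ℂ) (h : HasWeakPartial Ω i u g) : HasWeakPartial Ω i (c • u) (c • g) := by
  intro φ h1 h2 h3
  have A : ∫ x in Ω, partialD i φ x • (c • u) x = ∫ x in Ω, c • (partialD i φ x • u x) := by
    refine integral_congr_ae ?_
    filter_upwards [Lp.coeFn_smul c u] with x hx
    rw [hx, Pi.smul_apply, smul_comm]
  have B : ∫ x in Ω, φ x • (c • g) x = ∫ x in Ω, c • (φ x • g x) := by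
    refine integral_congr_ae ?_
    filter_upwards [Lp.coeFn_smul c g] with x hx
    rw [hx, Pi.smul_apply, smul_comm]
  rw [A, B, integral_smul, integral_smul, h φ h1 h2 h3, smul_neg]

theorem HasWeakPartial.zero {d : ℕ} {Ω : Set (E d)} {i : Fin d} :
    HasWeakPartial Ω i (0 : L2 Ω) 0 := by
  intro φ h1 h2 h3
  have A : ∀ η : E d → ℝ, ∫ x in Ω, η x • (0 : L2 Ω) x = 0 := by
    intro η
    refine integral_eq_zero_of_ae ?_
    filter_upwards [Lp.coeFn_zero ℂ 2 (volume.restrict Ω)] with x hx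
    rw [hx]; simp
  rw [A, A, neg_zero]

/-- The Sobolev space `H¹(Ω)`, an element `u` being recorded as the tuple
`(u, ∂_1 u, …, ∂_d u)` of `L²` functions: entry `0` is the function, entry `i.succ` its weak
partial derivative `∂_i u`. The norm inherited from the Hilbert sum is
`‖u‖_1 = (‖u‖² + ∑_i ‖∂_i u‖²)^(1/2)`. -/
def H1 {d : ℕ} (Ω : Set (E d)) : Submodule ℂ (L2Tuple Ω) where
  carrier := {p | ∀ i : Fin d, HasWeakPartial Ω i (p 0) (p i.succ)}
  add_mem' := fun h h' i => (h i).add (h' i)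
  zero_mem' := fun _ => HasWeakPartial.zero
  smul_mem' := fun c _ h i => (h i).smul c

/-- `q` is the tuple `(ψ|_Ω, ∂_1 ψ|_Ω, …, ∂_d ψ|_Ω)` of the function `ψ`, smooth on `ℝ^d`. -/
def IsSmoothTuple {d : ℕ} (Ω : Set (E d)) (ψ : E d → ℂ) (q : L2Tuple Ω) : Prop :=
  ContDiff ℝ ∞ ψ ∧ q 0 =ᵐ[volume.restrict Ω] ψ ∧
    ∀ i : Fin d, q i.succ =ᵐ[volume.restrict Ω] partialD i ψ

/-- `u ∈ H¹(Ω)` has the trace `g` on the part `Γ` of the boundary: `(u, g)` is a limit, in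
`H¹(Ω) × L²(Γ)`, of pairs `(ψ|_Ω, ψ|_Γ)` with `ψ` smooth on `ℝ^d`. Here `L²(Γ)` is taken with
respect to the surface measure, the `(d - 1)`-dimensional Hausdorff measure. -/
def HasTrace {d : ℕ} (Ω Γ : Set (E d)) (p : L2Tuple Ω) (g : E d → ℂ) : Prop :=
  ∀ ε : ℝ, 0 < ε → ∃ (ψ : E d → ℂ) (q : L2Tuple Ω), IsSmoothTuple Ω ψ q ∧ ‖p - q‖ < ε ∧
    eLpNorm (ψ - g) 2 ((Measure.hausdorffMeasure ((d : ℝ) - 1)).restrict Γ) < ENNReal.ofReal ε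

theorem IsSmoothTuple.add {d : ℕ} {Ω : Set (E d)} {ψ ψ' : E d → ℂ} {q q' : L2Tuple Ω}
    (h : IsSmoothTuple Ω ψ q) (h' : IsSmoothTuple Ω ψ' q') :
    IsSmoothTuple Ω (ψ + ψ') (q + q') := by
  refine ⟨h.1.add h'.1, ?_, fun i => ?_⟩
  · filter_upwards [Lp.coeFn_add (q 0) (q' 0), h.2.1, h'.2.1] with x h1 h2 h3
    rw [PiLp.add_apply, h1, Pi.add_apply, Pi.add_apply, h2, h3]
  · filter_upwards [Lp.coeFn_add (q i.succ) (q' i.succ), h.2.2 i, h'.2.2 i] with x h1 h2 h3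
    rw [PiLp.add_apply, h1, Pi.add_apply, h2, h3]
    have d1 : DifferentiableAt ℝ ψ x := (h.1.differentiable (by simp)) x
    have d2 : DifferentiableAt ℝ ψ' x := (h'.1.differentiable (by simp)) x
    simp only [partialD]
    rw [fderiv_add d1 d2]
    rfl

theorem IsSmoothTuple.smul {d : ℕ} {Ω : Set (E d)} {ψ : E d → ℂ} {q : L2Tuple Ω} (c : ℂ)
    (h : IsSmoothTuple Ω ψ q) : IsSmoothTuple Ω (c • ψ) (c • q) := by
  refine ⟨h.1.const_smul c, ?_, fun i => ?_⟩
  · filter_upwards [Lp.coeFn_smul c (q 0), h.2.1] with x h1 h2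
    rw [PiLp.smul_apply, h1, Pi.smul_apply, Pi.smul_apply, h2]
  · filter_upwards [Lp.coeFn_smul c (q i.succ), h.2.2 i] with x h1 h2
    rw [PiLp.smul_apply, h1, Pi.smul_apply, h2]
    have d1 : DifferentiableAt ℝ ψ x := (h.1.differentiable (by simp)) x
    simp only [partialD]
    rw [fderiv_const_smul d1]
    rfl

theorem HasTrace.add_zero_trace {d : ℕ} {Ω Γ : Set (E d)} {p p' : L2Tuple Ω}
    (h : HasTrace Ω Γ p 0) (h' : HasTrace Ω Γ p' 0) : HasTrace Ω Γ (p + p') 0 := by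
  intro ε hε
  obtain ⟨ψ, q, hq, h1, h2⟩ := h (ε / 2) (half_pos hε)
  obtain ⟨ψ', q', hq', h1', h2'⟩ := h' (ε / 2) (half_pos hε)
  refine ⟨ψ + ψ', q + q', hq.add hq', ?_, ?_⟩
  · calc ‖p + p' - (q + q')‖ = ‖(p - q) + (p' - q')‖ := by congr 1; abel
      _ ≤ ‖p - q‖ + ‖p' - q'‖ := norm_add_le _ _
      _ < ε := by linarith
  · rw [sub_zero] at *
    refine (eLpNorm_add_le hq.1.continuous.aestronglyMeasurable
      hq'.1.continuous.aestronglyMeasurable (by norm_num)).trans_lt ?_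
    calc _ < ENNReal.ofReal (ε / 2) + ENNReal.ofReal (ε / 2) := ENNReal.add_lt_add h2 h2'
      _ = ENNReal.ofReal ε := by
        rw [← ENNReal.ofReal_add (half_pos hε).le (half_pos hε).le, add_halves]

theorem HasTrace.zero {d : ℕ} {Ω Γ : Set (E d)} : HasTrace Ω Γ (0 : L2Tuple Ω) 0 := by
  intro ε hε
  refine ⟨0, 0, ⟨contDiff_const, ?_, fun i => ?_⟩, by simpa using hε, by simpa using hε⟩
  · exact Lp.coeFn_zero ℂ 2 (volume.restrict Ω)
  · filter_upwards [Lp.coeFn_zero ℂ 2 (volume.restrict Ω)] with x hx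
    rw [PiLp.zero_apply, hx]
    simp [partialD]

theorem HasTrace.smul_zero_trace {d : ℕ} {Ω Γ : Set (E d)} {p : L2Tuple Ω} (c : ℂ)
    (h : HasTrace Ω Γ p 0) : HasTrace Ω Γ (c • p) 0 := by
  rcases eq_or_ne c 0 with rfl | hc
  · rw [zero_smul]; exact HasTrace.zero
  intro ε hε
  have hc' : 0 < ‖c‖ := norm_pos_iff.2 hc
  obtain ⟨ψ, q, hq, h1, h2⟩ := h (ε / ‖c‖) (div_pos hε hc')
  refine ⟨c • ψ, c • q, hq.smul c, ?_, ?_⟩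
  · rw [← smul_sub, norm_smul]
    calc ‖c‖ * ‖p - q‖ < ‖c‖ * (ε / ‖c‖) := by gcongr
      _ = ε := by field_simp
  · rw [sub_zero] at *
    rw [eLpNorm_const_smul]
    have e : ENNReal.ofReal ε = ‖c‖ₑ * ENNReal.ofReal (ε / ‖c‖) := by
      rw [← ofReal_norm, ← ENNReal.ofReal_mul hc'.le]
      congr 1
      field_simp
    rw [e]
    exact ENNReal.mul_lt_mul_right (enorm_ne_zero.2 hc) enorm_ne_top h2

/-- The variational space `{v ∈ H¹(Ω) : v = 0 on Γ_D}`, with the norm of `H¹(Ω)`; the boundary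
condition is that `v` has the trace `0` on `Γ_D`. -/
def VD {d : ℕ} (Ω ΓD : Set (E d)) : Submodule ℂ (L2Tuple Ω) where
  carrier := {p | p ∈ H1 Ω ∧ HasTrace Ω ΓD p 0}
  add_mem' := fun h h' => ⟨(H1 Ω).add_mem h.1 h'.1, h.2.add_zero_trace h'.2⟩
  zero_mem' := ⟨(H1 Ω).zero_mem, HasTrace.zero⟩
  smul_mem' := fun c _ h => ⟨(H1 Ω).smul_mem c h.1, h.2.smul_zero_trace c⟩

/-- The inclusion of the variational space into `L²(Ω)`. -/
def incl {d : ℕ} (Ω ΓD : Set (E d)) : VD Ω ΓD →L[ℂ] L2 Ω :=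
  (PiLp.proj 2 (fun _ : Fin (d + 1) => L2 Ω) 0).comp (VD Ω ΓD).subtypeL

/-- The square of the part of highest order of the norm of `H^σ(Ω)`, `0 < σ ≤ 1`, as an extended
nonnegative number: for `σ < 1` the Gagliardo-Slobodeckij double integral
`∬ |g(x) - g(y)|² / |x - y|^(d + 2σ)`, for `σ = 1` the sum `∑_k ‖∂_k g‖²`, which is `∞` if `g`
does not belong to `H¹(Ω)`. -/
def fracSemiSq {d : ℕ} {Ω : Set (E d)} (σ : ℝ) (g : L2 Ω) : ℝ≥0∞ :=
  open Classical in
  if σ = 1 then ⨅ (q : H1 Ω) (_ : (q : L2Tuple Ω) 0 = g),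
    ∑ k : Fin d, ‖(q : L2Tuple Ω) k.succ‖ₑ ^ 2
  else ∫⁻ x in Ω, ∫⁻ y in Ω, ‖g x - g y‖ₑ ^ 2 / ‖x - y‖ₑ ^ ((d : ℝ) + 2 * σ)

/-- The norm of `H^s(Ω)`, `1 < s ≤ 2`, of `p ∈ H¹(Ω)`: the square root of
`‖p‖_1² + ∑_i |∂_i p|²_{s - 1}`; `p` belongs to `H^s(Ω)` if and only if this is finite. -/
def sobolevENorm {d : ℕ} {Ω : Set (E d)} (s : ℝ) (p : L2Tuple Ω) : ℝ≥0∞ :=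
  (‖p‖ₑ ^ 2 + ∑ i : Fin d, fracSemiSq (s - 1) (p i.succ)) ^ (1 / 2 : ℝ)

/-! ### The form -/

/-- The integrand of the form with the coefficients `a i j`, `0 ≤ i, j ≤ d`:
`∑_{i,j ≥ 1} a_{i,j} u_i conj(v_j) + ∑_{i ≥ 1} (a_{i,0} u_i conj(v) + a_{0,i} u conj(v_i))
  + a_{0,0} u conj(v)`, with `u_i = ∂_i u`. -/
def formIntegrand {d : ℕ} {Ω : Set (E d)} (a : Fin (d + 1) → Fin (d + 1) → E d → ℂ)
    (u v : L2Tuple Ω) (x : E d) : ℂ :=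
  (∑ i : Fin d, ∑ j : Fin d, a i.succ j.succ x * u i.succ x * starRingEnd ℂ (v j.succ x))
    + (∑ i : Fin d, (a i.succ 0 x * u i.succ x * starRingEnd ℂ (v 0 x)
        + a 0 i.succ x * u 0 x * starRingEnd ℂ (v i.succ x)))
    + a 0 0 x * u 0 x * starRingEnd ℂ (v 0 x)

/-- The sesquilinear form `A(u, v)` on the variational space. -/
def sesqForm {d : ℕ} (Ω ΓD : Set (E d)) (a : Fin (d + 1) → Fin (d + 1) → E d → ℂ)
    (u v : VD Ω ΓD) : ℂ :=
  ∫ x in Ω, formIntegrand a (u : L2Tuple Ω) (v : L2Tuple Ω) x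

/-- Elliptic regularity with index `α` for the form `a`: for `s ∈ (0, α]`, the solution map of
`a(T F, φ) = F(φ)` is bounded from `Ḣ^(-1+s)` (antilinear functionals) to `H^(1+s)(Ω) ∩ V`, and
the solution map of `a(φ, T* F) = F(φ)` is bounded from `Ḣ^(-1+s)` (linear functionals) to
`H^(1+s)(Ω) ∩ V`. -/
def EllipticRegularity {d : ℕ} (Ω ΓD : Set (E d)) (a : VD Ω ΓD → VD Ω ΓD → ℂ) (α : ℝ) : Prop :=
  ∀ s : ℝ, 0 < s → s ≤ α →
    (∃ C : ℝ≥0, ∀ (F : VD Ω ΓD →L⋆[ℂ] ℂ) (M : ℝ≥0), DotDualBound (incl Ω ΓD) a (1 - s) F M →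
      sobolevENorm (1 + s) ((solveForm a F : VD Ω ΓD) : L2Tuple Ω) ≤ C * M) ∧
    (∃ C : ℝ≥0, ∀ (F : VD Ω ΓD →L[ℂ] ℂ) (M : ℝ≥0), DotDualBound (incl Ω ΓD) a (1 - s) F M →
      sobolevENorm (1 + s) ((solveFormAdj a F : VD Ω ΓD) : L2Tuple Ω) ≤ C * M)

/-- The continuous embedding `D(B ^ (s / 2)) ⊂ H^s(Ω) ∩ V`, `1 < s ≤ 2`, for the operator `B` of
the form `b`, where `D(B ^ (s / 2))` has the norm `‖B ^ (s / 2) u‖`. -/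
def PowDomainEmbeds {d : ℕ} (Ω ΓD : Set (E d)) (b : VD Ω ΓD → VD Ω ΓD → ℂ) (s : ℝ) : Prop :=
  ∃ C : ℝ≥0, ∀ u w : L2 Ω, IsPow (incl Ω ΓD) b (s / 2) u w →
    ∃ p : VD Ω ΓD, incl Ω ΓD p = u ∧ sobolevENorm s (p : L2Tuple Ω) ≤ C * ‖w‖ₑ

end RegAcc

end

/-! Put γ = 1 - s/2, so 0 ≤ γ < 1/2. Let A^(1-γ) u = w. The core is that u lies in V and |A(u, θ)| ≤
C ‖w‖ ‖S^γ θ‖ for every θ ∈ V ∩ D(S^γ). The functional A(u, ·) then lies in the dual of Ḣ^(2γ) =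
Ḣ^(1-t) with t = s - 1, and u is its image under T_a, so elliptic regularity with index t places u
in H^(1+t) = H^s. For A* the same argument runs with the adjoint form and T_l^*; the Hermitian part
is the same S.

The core estimate is Kato's comparison of fractional powers of order below 1/2, in dual form. It is
proved for any two bounded coercive forms a, b on the same space V (`exists_bound_form`), with
operators A and B. Write R_μ = (μ + A)⁻¹ and ψ_μ = A R_μ² = d/dμ (μ R_μ), and let R'_ν, ψ'_ν be the
same objects for B.

Up to constants, u is the Balakrishnan integral ∫ μ^(γ-1) R_μ w dμ and θ is ∫ ν^(-γ) R'_ν ζ dν with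
ζ = B^γ θ. This rests on `balakrishnan_comp`: the integrals of exponents γ and 1 - γ compose to a
nonzero multiple of A⁻¹. Since ‖R_μ w‖_V decays like μ^(-1/2) and 1 - γ > 1/2, the integral of u
converges in V. Integration by parts turns both integrals into integrals of ψ (`form_integral_resV`,
`smul_balakrishnan_eq`), so a(u, θ) becomes a multiple of ∬ μ^γ ν^(-γ) (ψ_μ w, ψ'_ν ζ) dν dμ.

Two facts bound this double integral. With P(μ) = Re (w, ψ_μ w) and Q(ν) = Re (ζ, ψ'_ν ζ) one has ∫
P ≤ ‖w‖² and ∫ Q ≤ ‖ζ‖², each integrand being the derivative of a bounded increasing function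
(`lintegral_quadratic_le`). The densities P and Q control ψ, ψ' and the resolvents in V, and this
gives |(ψ_μ w, ψ'_ν ζ)| ≤ K min(1/μ, 1/√(μν)) √P(μ) √Q(ν) (`norm_inner_resPsi_le`). The bound 1/μ is
where the common form domain enters. The kernel μ^γ ν^(-γ) min(1/μ, 1/√(μν)) is homogeneous of
degree -1, and for 0 < γ < 1/2 it passes the Schur test (`lintegral_kernel_le`). -/

noncomputable section

namespace RegAcc

/-! ### Resolvents of a coercive form and their bounds. -/

section Resolvent

open Filter Topology

variable {V H : Type*} [NormedAddCommGroup V] [InnerProductSpace ℂ V]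
  [NormedAddCommGroup H] [InnerProductSpace ℂ H]

/-- The form `a` on `V` is represented by the bounded operator `T`, it is coercive with the
constant `c`, and `V` is dense in `H`. -/
structure IsRegAccretive (j : V →L[ℂ] H) (a : V → V → ℂ) (T : V →L[ℂ] V) (c : ℝ) : Prop where
  pos : 0 < c
  repr : ∀ u v, a u v = ⟪v, T u⟫_ℂ
  coercive : ∀ v, c * ‖v‖ ^ 2 ≤ (⟪v, T v⟫_ℂ).re
  dense : DenseRange j

/-- A bounded operator with coercive quadratic form is bijective. -/
theorem bijective_of_coercive [CompleteSpace V] {T : V →L[ℂ] V} {c : ℝ} (hc : 0 < c)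
    (h : ∀ v, c * ‖v‖ ^ 2 ≤ (⟪v, T v⟫_ℂ).re) : Function.Bijective T := by
  have hb : ∀ v, c * ‖v‖ ≤ ‖T v‖ := by
    intro v
    rcases eq_or_ne v 0 with rfl | hv
    · simp
    · have hv' : 0 < ‖v‖ := norm_pos_iff.2 hv
      refine le_of_mul_le_mul_right ?_ hv'
      calc c * ‖v‖ * ‖v‖ = c * ‖v‖ ^ 2 := by ring
        _ ≤ (⟪v, T v⟫_ℂ).re := h v
        _ ≤ ‖⟪v, T v⟫_ℂ‖ := Complex.re_le_norm _
        _ ≤ ‖v‖ * ‖T v‖ := norm_inner_le_norm _ _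
        _ = ‖T v‖ * ‖v‖ := mul_comm _ _
  have hanti : AntilipschitzWith (c⁻¹).toNNReal T := by
    refine ContinuousLinearMap.antilipschitz_of_bound T fun v => ?_
    rw [Real.coe_toNNReal _ (inv_pos.2 hc).le, ← inv_mul_le_iff₀ (inv_pos.2 hc), inv_inv]
    exact hb v
  refine ⟨hanti.injective, ?_⟩
  have hcl : IsClosed (T.range : Set V) := hanti.isClosed_range T.uniformContinuous
  have hcs := hcl.completeSpace_coe
  have htop : T.range = ⊤ := by
    rw [← T.range.orthogonal_orthogonal, Submodule.eq_top_iff']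
    intro v w hw
    have hw0 : w = 0 := by
      have h0 : ⟪w, T w⟫_ℂ = 0 := by
        exact inner_eq_zero_symm.1 (hw (T w) ⟨w, rfl⟩)
      have h1 := h w
      rw [h0, Complex.zero_re] at h1
      have h2 : ‖w‖ ^ 2 ≤ 0 := by
        by_contra hcon
        push Not at hcon
        exact absurd h1 (not_le.2 (mul_pos hc hcon))
      exact norm_eq_zero.1 (pow_eq_zero_iff two_ne_zero |>.1 (le_antisymm h2 (sq_nonneg _)))
    rw [hw0]; exact inner_zero_left _
  intro y
  have : y ∈ T.range := htop ▸ Submodule.mem_top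
  exact this

theorem IsRegAccretive.eq_of_form_eq [CompleteSpace V] {j : V →L[ℂ] H} {a : V → V → ℂ}
    {T : V →L[ℂ] V} {c : ℝ} (h : IsRegAccretive j a T c) {u v : V} (huv : ∀ φ, a u φ = a v φ) :
    u = v := by
  have hb := bijective_of_coercive h.pos h.coercive
  refine hb.1 (ext_inner_left ℂ fun φ => ?_)
  rw [← h.repr, ← h.repr, huv]

/-- Every element of V is the solution for its own functional; elliptic regularity can therefore be
applied to an element already known to lie in V. -/
theorem IsRegAccretive.solveForm_eq [CompleteSpace V] {j : V →L[ℂ] H} {a : V → V → ℂ}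
    {T : V →L[ℂ] V} {c : ℝ} (h : IsRegAccretive j a T c) (p : V) : solveForm a (a p) = p := by
  have hs : ∀ φ, a (solveForm a (a p)) φ = a p φ :=
    Classical.epsilon_spec (p := fun q : V => ∀ φ : V, a q φ = a p φ) ⟨p, fun _ => rfl⟩
  exact h.eq_of_form_eq hs

variable [CompleteSpace V] [CompleteSpace H]

/-- The operator of the shifted form `a(u, v) + μ (u, v)`. -/
def shiftOp (j : V →L[ℂ] H) (T : V →L[ℂ] V) (μ : ℝ) : V →L[ℂ] V :=
  T + (μ : ℂ) • ((ContinuousLinearMap.adjoint j).comp j)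

/-- The resolvent `(μ + A)⁻¹` as an operator from `H` to `V`. -/
def resV (j : V →L[ℂ] H) (T : V →L[ℂ] V) (μ : ℝ) : H →L[ℂ] V :=
  (shiftOp j T μ).inverse.comp (ContinuousLinearMap.adjoint j)

/-- The resolvent `(μ + A)⁻¹` as an operator on `H`. -/
def resH (j : V →L[ℂ] H) (T : V →L[ℂ] V) (μ : ℝ) : H →L[ℂ] H := j.comp (resV j T μ)

/-- The derivative of `μ (μ + A)⁻¹`, that is, `A (μ + A)⁻²`. -/
def resPsi (j : V →L[ℂ] H) (T : V →L[ℂ] V) (μ : ℝ) (f : H) : H :=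
  resH j T μ f - (μ : ℂ) • resH j T μ (resH j T μ f)

theorem inner_shiftOp (j : V →L[ℂ] H) (T : V →L[ℂ] V) (μ : ℝ) (φ v : V) :
    ⟪φ, shiftOp j T μ v⟫_ℂ = ⟪φ, T v⟫_ℂ + (μ : ℂ) * ⟪j φ, j v⟫_ℂ := by
  simp [shiftOp, ContinuousLinearMap.adjoint_inner_right]

theorem resH_apply (j : V →L[ℂ] H) (T : V →L[ℂ] V) (μ : ℝ) (f : H) :
    resH j T μ f = j (resV j T μ f) := rfl

namespace IsRegAccretive

variable {j : V →L[ℂ] H} {a : V → V → ℂ} {T : V →L[ℂ] V} {c : ℝ}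

theorem shiftOp_coercive (h : IsRegAccretive j a T c) {μ : ℝ} (hμ : 0 ≤ μ) (v : V) :
    c * ‖v‖ ^ 2 ≤ (⟪v, shiftOp j T μ v⟫_ℂ).re := by
  rw [inner_shiftOp, inner_self_eq_norm_sq_to_K]
  have : ((μ : ℂ) * ((‖j v‖ : ℝ) : ℂ) ^ 2).re = μ * ‖j v‖ ^ 2 := by
    rw [← Complex.ofReal_pow, ← Complex.ofReal_mul, Complex.ofReal_re]
  have h2 := h.coercive v
  rw [Complex.add_re]
  erw [this]
  nlinarith [mul_nonneg hμ (sq_nonneg ‖j v‖)]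

theorem shiftOp_bijective (h : IsRegAccretive j a T c) {μ : ℝ} (hμ : 0 ≤ μ) :
    Function.Bijective (shiftOp j T μ) :=
  bijective_of_coercive h.pos (h.shiftOp_coercive hμ)

theorem shiftOp_inverse (h : IsRegAccretive j a T c) {μ : ℝ} (hμ : 0 ≤ μ) (x : V) :
    shiftOp j T μ ((shiftOp j T μ).inverse x) = x := by
  have hb := h.shiftOp_bijective hμ
  have e : (shiftOp j T μ)
      = ((ContinuousLinearEquiv.ofBijective (shiftOp j T μ) (LinearMap.ker_eq_bot.2 hb.1)
        (LinearMap.range_eq_top.2 hb.2) : V ≃L[ℂ] V) : V →L[ℂ] V) := by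
    ext; rfl
  rw [e, ContinuousLinearMap.inverse_equiv]
  simp

/-- The equation of the resolvent. -/
theorem resV_spec (h : IsRegAccretive j a T c) {μ : ℝ} (hμ : 0 ≤ μ) (f : H) (φ : V) :
    ⟪φ, T (resV j T μ f)⟫_ℂ + (μ : ℂ) * ⟪j φ, resH j T μ f⟫_ℂ = ⟪j φ, f⟫_ℂ := by
  rw [resH_apply, ← inner_shiftOp, resV, ContinuousLinearMap.comp_apply, h.shiftOp_inverse hμ,
    ContinuousLinearMap.adjoint_inner_right]

theorem resV_unique (h : IsRegAccretive j a T c) {μ : ℝ} (hμ : 0 ≤ μ) {f : H} {v : V}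
    (hv : ∀ φ : V, ⟪φ, T v⟫_ℂ + (μ : ℂ) * ⟪j φ, j v⟫_ℂ = ⟪j φ, f⟫_ℂ) : v = resV j T μ f := by
  refine (h.shiftOp_bijective hμ).1 (ext_inner_left ℂ fun φ => ?_)
  rw [inner_shiftOp, inner_shiftOp, hv, ← h.resV_spec hμ, resH_apply]

/-- The choice made by `Classical.epsilon` satisfies the equation because a solution exists, and
uniqueness identifies it with the operator resolvent. -/
theorem resolventOp_eq (h : IsRegAccretive j a T c) {μ : ℝ} (hμ : 0 ≤ μ) (f : H) :
    resolventOp j a μ f = resH j T μ f := by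
  rw [resolventOp, resH_apply]
  congr 1
  refine h.resV_unique hμ fun φ => ?_
  have hs := Classical.epsilon_spec
    (p := fun q : V => ∀ φ : V, a q φ + (μ : ℂ) * ⟪j φ, j q⟫_ℂ = ⟪j φ, f⟫_ℂ)
    ⟨resV j T μ f, fun φ => by rw [h.repr]; exact h.resV_spec hμ f φ⟩
  rw [← h.repr]
  exact hs φ

theorem solOp_eq (h : IsRegAccretive j a T c) (f : H) : solOp j a f = resH j T 0 f := by
  rw [← h.resolventOp_eq le_rfl, solOp, resolventOp]
  simp

/-- The resolvent identity. -/
theorem resV_sub (h : IsRegAccretive j a T c) {μ ν : ℝ} (hμ : 0 ≤ μ) (hν : 0 ≤ ν) (f : H) :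
    resV j T μ f - resV j T ν f = ((ν - μ : ℝ) : ℂ) • resV j T μ (resH j T ν f) := by
  have : resV j T ν f = resV j T μ (f - ((ν - μ : ℝ) : ℂ) • resH j T ν f) := by
    refine h.resV_unique hμ fun φ => ?_
    rw [inner_sub_right, inner_smul_right, ← h.resV_spec hν f φ, resH_apply]
    push_cast
    ring
  rw [this, map_sub, map_smul]
  abel

theorem resH_sub (h : IsRegAccretive j a T c) {μ ν : ℝ} (hμ : 0 ≤ μ) (hν : 0 ≤ ν) (f : H) :
    resH j T μ f - resH j T ν f = ((ν - μ : ℝ) : ℂ) • resH j T μ (resH j T ν f) := by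
  rw [resH_apply, resH_apply _ _ ν, ← map_sub, h.resV_sub hμ hν, map_smul, ← resH_apply,
    ← resH_apply]

/-- The resolvent equation tested with the solution itself. -/
theorem re_inner_resH (h : IsRegAccretive j a T c) {μ : ℝ} (hμ : 0 ≤ μ) (f : H) :
    (⟪resV j T μ f, T (resV j T μ f)⟫_ℂ).re + μ * ‖resH j T μ f‖ ^ 2
      = (⟪resH j T μ f, f⟫_ℂ).re := by
  have h1 := h.resV_spec hμ f (resV j T μ f)
  rw [← resH_apply, inner_self_eq_norm_sq_to_K] at h1
  have h2 := congrArg Complex.re h1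
  rw [Complex.add_re] at h2
  have : ((μ : ℂ) * ((‖resH j T μ f‖ : ℝ) : ℂ) ^ 2).re = μ * ‖resH j T μ f‖ ^ 2 := by
    rw [← Complex.ofReal_pow, ← Complex.ofReal_mul, Complex.ofReal_re]
  rw [← this]
  exact h2

/-- Source of all resolvent bounds: dropping one of the two terms on the left controls the other. -/
theorem energy (h : IsRegAccretive j a T c) {μ : ℝ} (hμ : 0 ≤ μ) (f : H) :
    c * ‖resV j T μ f‖ ^ 2 + μ * ‖resH j T μ f‖ ^ 2 ≤ ‖resH j T μ f‖ * ‖f‖ := by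
  have h1 := h.re_inner_resH hμ f
  have h2 := h.coercive (resV j T μ f)
  have h3 : (⟪resH j T μ f, f⟫_ℂ).re ≤ ‖resH j T μ f‖ * ‖f‖ :=
    (Complex.re_le_norm _).trans (norm_inner_le_norm _ _)
  linarith

theorem norm_resH_le (h : IsRegAccretive j a T c) {μ : ℝ} (hμ : 0 ≤ μ) (f : H) :
    μ * ‖resH j T μ f‖ ≤ ‖f‖ := by
  have h1 := h.energy hμ f
  rcases (norm_nonneg (resH j T μ f)).eq_or_lt with h0 | h0
  · rw [← h0, mul_zero]; exact norm_nonneg _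
  · refine le_of_mul_le_mul_right ?_ h0
    nlinarith [mul_nonneg h.pos.le (sq_nonneg ‖resV j T μ f‖)]

theorem norm_resV_le (h : IsRegAccretive j a T c) {μ : ℝ} (hμ : 0 ≤ μ) (f : H) :
    c * ‖resV j T μ f‖ ≤ ‖j‖ * ‖f‖ := by
  have h1 := h.energy hμ f
  rcases (norm_nonneg (resV j T μ f)).eq_or_lt with h0 | h0
  · rw [← h0, mul_zero]; positivity
  · refine le_of_mul_le_mul_right ?_ h0
    have h2 : ‖resH j T μ f‖ ≤ ‖j‖ * ‖resV j T μ f‖ := j.le_opNorm _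
    have h3 := mul_le_mul_of_nonneg_right h2 (norm_nonneg f)
    nlinarith [mul_nonneg hμ (sq_nonneg ‖resH j T μ f‖)]

/-- Decay of order μ^(-1/2) in the norm of V; it is what makes Balakrishnan integrals of exponent
above 1/2 converge in V. -/
theorem norm_resV_sq_le (h : IsRegAccretive j a T c) {μ : ℝ} (hμ : 0 ≤ μ) (f : H) :
    c * μ * ‖resV j T μ f‖ ^ 2 ≤ ‖f‖ ^ 2 := by
  have h1 := h.energy hμ f
  have h2 := h.norm_resH_le hμ f
  have h3 := mul_le_mul_of_nonneg_right h2 (norm_nonneg f)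
  have h4 := mul_le_mul_of_nonneg_left h1 hμ
  nlinarith [sq_nonneg (μ * ‖resH j T μ f‖)]

theorem norm_resH_le' (h : IsRegAccretive j a T c) {μ : ℝ} (hμ : 0 ≤ μ) (f : H) :
    ‖resH j T μ f‖ ≤ ‖j‖ * ‖j‖ / c * ‖f‖ := by
  have h1 := h.norm_resV_le hμ f
  have h2 : ‖resH j T μ f‖ ≤ ‖j‖ * ‖resV j T μ f‖ := j.le_opNorm _
  rw [div_mul_eq_mul_div, le_div_iff₀ h.pos]
  nlinarith [mul_le_mul_of_nonneg_left h1 (norm_nonneg j), h.pos]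

/-- The resolvent is continuous. -/
theorem continuousOn_resV (h : IsRegAccretive j a T c) (f : H) :
    ContinuousOn (fun μ => resV j T μ f) (Set.Ici 0) := by
  intro μ hμ
  rw [ContinuousWithinAt, tendsto_iff_norm_sub_tendsto_zero]
  have hlim : Tendsto (fun ν : ℝ => |μ - ν| * (‖j‖ * ‖resH j T μ f‖ / c)) (𝓝[Set.Ici 0] μ)
      (𝓝 0) := by
    have : Continuous (fun ν : ℝ => |μ - ν| * (‖j‖ * ‖resH j T μ f‖ / c)) := by fun_prop
    have h2 := (this.tendsto μ).mono_left (nhdsWithin_le_nhds (s := Set.Ici 0))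
    simpa using h2
  refine squeeze_zero' (Eventually.of_forall fun _ => norm_nonneg _) ?_ hlim
  filter_upwards [self_mem_nhdsWithin] with ν hν
  rw [h.resV_sub hν hμ, norm_smul, Complex.norm_real, Real.norm_eq_abs]
  refine mul_le_mul_of_nonneg_left ?_ (abs_nonneg _)
  rw [le_div_iff₀ h.pos, mul_comm]
  exact h.norm_resV_le hν _

theorem continuousOn_resH (h : IsRegAccretive j a T c) (f : H) :
    ContinuousOn (fun μ => resH j T μ f) (Set.Ici 0) :=
  j.continuous.comp_continuousOn (h.continuousOn_resV f)

/-- Continuity of the resolvent jointly in the parameter and the vector. -/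
theorem continuousOn_resH_comp (h : IsRegAccretive j a T c) {X : Type*} [TopologicalSpace X]
    {s : Set X} {m : X → ℝ} {g : X → H} (hm : ContinuousOn m s) (hg : ContinuousOn g s)
    (hpos : ∀ x ∈ s, 0 ≤ m x) : ContinuousOn (fun x => resH j T (m x) (g x)) s := by
  intro x hx
  have h1 : Tendsto (fun y => resH j T (m y) (g x)) (𝓝[s] x) (𝓝 (resH j T (m x) (g x))) := by
    have := h.continuousOn_resH (g x) (m x) (hpos x hx)
    exact this.tendsto.comp (tendsto_nhdsWithin_iff.2
      ⟨hm x hx, eventually_nhdsWithin_of_forall fun y hy => hpos y hy⟩)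
  have h2 : Tendsto (fun y => resH j T (m y) (g y - g x)) (𝓝[s] x) (𝓝 0) := by
    have hl : Tendsto (fun y => ‖j‖ * ‖j‖ / c * ‖g y - g x‖) (𝓝[s] x) (𝓝 0) := by
      have := (tendsto_iff_norm_sub_tendsto_zero.1 (hg x hx)).const_mul (‖j‖ * ‖j‖ / c)
      simpa using this
    refine squeeze_zero_norm' ?_ hl
    filter_upwards [self_mem_nhdsWithin] with y hy
    exact h.norm_resH_le' (hpos y hy) _
  have h3 := h1.add h2
  rw [add_zero] at h3
  refine h3.congr fun y => ?_
  rw [← map_add]; congr 1; abel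

/-! ### Differentiation in the parameter and the quadratic estimate. -/

theorem hasDerivAt_resH (h : IsRegAccretive j a T c) {μ : ℝ} (hμ : 0 < μ) (f : H) :
    HasDerivAt (fun μ => resH j T μ f) (-resH j T μ (resH j T μ f)) μ := by
  rw [hasDerivAt_iff_tendsto_slope]
  have hc : Tendsto (fun ν => -resH j T ν (resH j T μ f)) (𝓝[≠] μ)
      (𝓝 (-resH j T μ (resH j T μ f))) :=
    ((h.continuousOn_resH _).continuousAt (Ici_mem_nhds hμ)).tendsto.neg.mono_left
      nhdsWithin_le_nhds
  refine hc.congr' ?_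
  filter_upwards [self_mem_nhdsWithin, nhdsWithin_le_nhds (Ioi_mem_nhds hμ)] with ν hν hν0
  have hne : ν - μ ≠ 0 := sub_ne_zero.2 hν
  rw [slope_def_module, h.resH_sub (le_of_lt hν0) hμ.le, ← neg_sub ν μ, Complex.ofReal_neg,
    neg_smul, smul_neg, Complex.coe_smul, smul_smul, inv_mul_cancel₀ hne, one_smul]

theorem hasDerivAt_smul_resH (h : IsRegAccretive j a T c) {μ : ℝ} (hμ : 0 < μ) (f : H) :
    HasDerivAt (fun μ : ℝ => (μ : ℂ) • resH j T μ f) (resPsi j T μ f) μ := by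
  have h1 : HasDerivAt (fun μ : ℝ => (μ : ℂ)) 1 μ := Complex.ofRealCLM.hasDerivAt
  have h2 := h1.smul (h.hasDerivAt_resH hμ f)
  refine h2.congr_deriv ?_
  rw [resPsi, one_smul, smul_neg]; abel

/-- Shows ψ_μ f as the image of an element of V, so that it can serve as a test function for another
form. -/
theorem resPsi_eq (j : V →L[ℂ] H) (T : V →L[ℂ] V) (μ : ℝ) (f : H) :
    resPsi j T μ f = resH j T μ (f - (μ : ℂ) • resH j T μ f) := by
  rw [resPsi, map_sub, map_smul]

/-- The resolvent equation with right-hand side R_μ f; pairing ψ_μ f with an element of V gives back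
the form. -/
theorem inner_resPsi (h : IsRegAccretive j a T c) {μ : ℝ} (hμ : 0 ≤ μ) (f : H) (φ : V) :
    ⟪j φ, resPsi j T μ f⟫_ℂ = ⟪φ, T (resV j T μ (resH j T μ f))⟫_ℂ := by
  rw [resPsi, inner_sub_right, inner_smul_right, ← h.resV_spec hμ (resH j T μ f) φ]
  ring

/-- The density of the quadratic estimate. -/
theorem quadratic_density (h : IsRegAccretive j a T c) {μ : ℝ} (hμ : 0 ≤ μ) (f : H) :
    c * (μ * ‖resV j T μ (resH j T μ f)‖) ^ 2 + 2 * μ * ‖resPsi j T μ f‖ ^ 2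
      + c * ‖resV j T μ (f - (μ : ℂ) • resH j T μ f)‖ ^ 2 ≤ (⟪f, resPsi j T μ f⟫_ℂ).re := by
  have hψ0 : resPsi j T μ f = resH j T μ f - (μ : ℂ) • resH j T μ (resH j T μ f) := rfl
  set z := f - (μ : ℂ) • resH j T μ f with hz
  set w := resV j T μ (resH j T μ f) with hw
  have hψ : resPsi j T μ f = resH j T μ z := resPsi_eq j T μ f
  -- With z = f - μ R_μ f, formally A R_μ f, split f = z + μ R_μ f and R_μ f = ψ_μ f + μ R_μ² f.
  -- Paired with ψ_μ f, the z-part yields the energy of R_μ z plus μ ‖ψ_μ f‖², and the rest yields μ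
  -- ‖ψ_μ f‖² plus μ² times the energy of w.
  have hf : f = z + (μ : ℂ) • (resPsi j T μ f + (μ : ℂ) • j w) := by
    rw [hψ0, hw, ← resH_apply, hz]; simp
  have e1 : (⟪z, resPsi j T μ f⟫_ℂ).re
      = (⟪resV j T μ z, T (resV j T μ z)⟫_ℂ).re + μ * ‖resPsi j T μ f‖ ^ 2 := by
    rw [hψ, h.re_inner_resH hμ z]
    exact inner_re_symm (𝕜 := ℂ) _ _
  have e2 : (⟪resPsi j T μ f, resPsi j T μ f⟫_ℂ).re = ‖resPsi j T μ f‖ ^ 2 :=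
    inner_self_eq_norm_sq (𝕜 := ℂ) _
  have e3 : (⟪f, resPsi j T μ f⟫_ℂ).re = (⟪z, resPsi j T μ f⟫_ℂ).re
      + μ * ((⟪resPsi j T μ f, resPsi j T μ f⟫_ℂ).re + μ * (⟪w, T w⟫_ℂ).re) := by
    conv_lhs => rw [hf]
    rw [inner_add_left, inner_smul_left, inner_add_left, inner_smul_left, h.inner_resPsi hμ,
      Complex.conj_ofReal, Complex.add_re, Complex.re_ofReal_mul, Complex.add_re,
      Complex.re_ofReal_mul]
    rw [← hf]
  have k1 := h.coercive (resV j T μ z)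
  have k2 := mul_le_mul_of_nonneg_left (h.coercive w) (mul_nonneg hμ hμ)
  rw [e3, e1, e2]
  nlinarith

theorem resPsi_re_nonneg (h : IsRegAccretive j a T c) {μ : ℝ} (hμ : 0 ≤ μ) (f : H) :
    0 ≤ (⟪f, resPsi j T μ f⟫_ℂ).re := by
  refine le_trans ?_ (h.quadratic_density hμ f)
  have := h.pos
  positivity

theorem continuousOn_resPsi (h : IsRegAccretive j a T c) (f : H) :
    ContinuousOn (fun μ => resPsi j T μ f) (Set.Ici 0) := by
  have h1 := h.continuousOn_resH f
  have h2 := h.continuousOn_resH_comp (s := Set.Ici 0) continuousOn_id h1 (fun x hx => hx)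
  exact h1.sub (Complex.continuous_ofReal.continuousOn.smul h2)

/-- The quadratic estimate. -/
theorem lintegral_quadratic_le (h : IsRegAccretive j a T c) (f : H) :
    ∫⁻ μ in Set.Ioi (0 : ℝ), ENNReal.ofReal (⟪f, resPsi j T μ f⟫_ℂ).re
      ≤ ENNReal.ofReal (‖f‖ ^ 2) := by
  -- The integrand is g'. It is nonnegative, g(0) = 0, and g ≤ ‖f‖² because μ R_μ is a contraction;
  -- hence g has a limit at ∞, and the integral equals that limit.
  set g : ℝ → ℝ := fun μ => (⟪f, (μ : ℂ) • resH j T μ f⟫_ℂ).re with hg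
  have hg0 : g 0 = 0 := by simp [hg]
  have hder : ∀ μ ∈ Set.Ioi (0 : ℝ), HasDerivAt g ((⟪f, resPsi j T μ f⟫_ℂ).re) μ := by
    intro μ hμ
    have h1 := ((innerSL ℂ f).restrictScalars ℝ).hasFDerivAt.comp_hasDerivAt μ
      (h.hasDerivAt_smul_resH hμ f)
    exact (Complex.reCLM.hasFDerivAt.comp_hasDerivAt μ h1)
  have hcont : ContinuousOn g (Set.Ici 0) := by
    have h1 : ContinuousOn (fun μ : ℝ => (μ : ℂ) • resH j T μ f) (Set.Ici 0) :=
      Complex.continuous_ofReal.continuousOn.smul (h.continuousOn_resH f)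
    exact Complex.continuous_re.comp_continuousOn (continuousOn_const.inner h1)
  have hpos : ∀ μ ∈ Set.Ioi (0 : ℝ), 0 ≤ (⟪f, resPsi j T μ f⟫_ℂ).re :=
    fun μ hμ => h.resPsi_re_nonneg (le_of_lt hμ) f
  have hbound : ∀ μ, 0 ≤ μ → g μ ≤ ‖f‖ ^ 2 := by
    intro μ hμ
    refine (Complex.re_le_norm _).trans ((norm_inner_le_norm _ _).trans ?_)
    rw [norm_smul, Complex.norm_real, Real.norm_of_nonneg hμ, sq]
    exact mul_le_mul_of_nonneg_left (h.norm_resH_le hμ f) (norm_nonneg _)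
  have hmono : MonotoneOn g (Set.Ici 0) := by
    refine monotoneOn_of_deriv_nonneg (convex_Ici 0) hcont ?_ ?_
    · rw [interior_Ici]
      exact fun μ hμ => (hder μ hμ).differentiableAt.differentiableWithinAt
    · rw [interior_Ici]
      exact fun μ hμ => (hder μ hμ).deriv ▸ hpos μ hμ
  have hmono' : Monotone fun μ => g (max μ 0) := fun x y hxy =>
    hmono (Set.mem_Ici.2 (le_max_right _ _)) (Set.mem_Ici.2 (le_max_right _ _))
      (max_le_max hxy le_rfl)
  have hlim : ∃ l, Tendsto g atTop (𝓝 l) ∧ l ≤ ‖f‖ ^ 2 := by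
    have hb : BddAbove (Set.range fun μ => g (max μ 0)) :=
      ⟨‖f‖ ^ 2, by rintro _ ⟨μ, rfl⟩; exact hbound _ (le_max_right _ _)⟩
    have ht := tendsto_atTop_ciSup hmono' hb
    refine ⟨_, ht.congr' ?_, ciSup_le fun μ => hbound _ (le_max_right _ _)⟩
    filter_upwards [eventually_ge_atTop (0 : ℝ)] with μ hμ
    rw [max_eq_left hμ]
  obtain ⟨l, hl, hl2⟩ := hlim
  have hc0 : ContinuousWithinAt g (Set.Ici 0) 0 := hcont 0 Set.self_mem_Ici
  have hI := integral_Ioi_of_hasDerivAt_of_nonneg hc0 hder hpos hl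
  have hInt := integrableOn_Ioi_deriv_of_nonneg hc0 hder hpos hl
  rw [← ofReal_integral_eq_lintegral_ofReal hInt
    ((ae_restrict_mem measurableSet_Ioi).mono fun μ hμ => hpos μ hμ), hI, hg0, sub_zero]
  exact ENNReal.ofReal_le_ofReal hl2

/-- The solution operator is injective. -/
theorem resH_zero_injective (h : IsRegAccretive j a T c) : Function.Injective (resH j T 0) := by
  rw [injective_iff_map_eq_zero]
  intro f hf
  have h1 := h.re_inner_resH le_rfl f
  have h2 := h.coercive (resV j T 0 f)
  rw [hf, inner_zero_left, Complex.zero_re, zero_mul, add_zero] at h1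
  rw [h1] at h2
  have h3 : resV j T 0 f = 0 := by
    have : ‖resV j T 0 f‖ ^ 2 ≤ 0 := by
      by_contra hcon
      push Not at hcon
      exact absurd h2 (not_le.2 (mul_pos h.pos hcon))
    exact norm_eq_zero.1 (pow_eq_zero_iff two_ne_zero |>.1 (le_antisymm this (sq_nonneg _)))
  have h4 : ∀ φ, ⟪j φ, f⟫_ℂ = 0 := by
    intro φ
    rw [← h.resV_spec le_rfl f φ, h3, hf]
    simp
  exact h.dense.eq_zero_of_inner_right ℂ h4

end IsRegAccretive

end Resolvent

/-! ### Integrals against powers on the half-line. -/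

section HalfLine

open Filter Topology Set

/-- A continuous function on the half-line, dominated by an integrable power at `0` and by one
at `∞`, is integrable. -/
theorem integrableOn_Ioi_of_norm_le_rpow {X : Type*} [NormedAddCommGroup X] {g : ℝ → X}
    (hg : ContinuousOn g (Ioi 0)) {C p q : ℝ} (hp : -1 < p) (hq : q < -1)
    (h0 : ∀ μ, 0 < μ → ‖g μ‖ ≤ C * μ ^ p) (h1 : ∀ μ, 0 < μ → ‖g μ‖ ≤ C * μ ^ q) :
    IntegrableOn g (Ioi 0) := by
  have hm := hg.aestronglyMeasurable (μ := volume) measurableSet_Ioi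
  rw [← Ioc_union_Ioi_eq_Ioi (zero_le_one (α := ℝ)), integrableOn_union]
  constructor
  · have hi : IntegrableOn (fun μ : ℝ => C * μ ^ p) (Ioc 0 1) := by
      have := (intervalIntegral.intervalIntegrable_rpow' (a := 0) (b := 1) hp).const_mul C
      rwa [intervalIntegrable_iff_integrableOn_Ioc_of_le zero_le_one] at this
    refine Integrable.mono' hi (hm.mono_measure (Measure.restrict_mono Ioc_subset_Ioi_self le_rfl))
      ((ae_restrict_mem measurableSet_Ioc).mono fun μ hμ => h0 μ hμ.1)
  · have hi : IntegrableOn (fun μ : ℝ => C * μ ^ q) (Ioi 1) :=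
      (integrableOn_Ioi_rpow_of_lt hq one_pos).const_mul C
    have hs : Ioi (1 : ℝ) ⊆ Ioi 0 := Ioi_subset_Ioi zero_le_one
    refine Integrable.mono' hi (hm.mono_measure (Measure.restrict_mono hs le_rfl))
      ((ae_restrict_mem measurableSet_Ioi).mono fun μ hμ => h1 μ (hs hμ))

theorem continuousOn_rpow_Ioi (b : ℝ) : ContinuousOn (fun μ : ℝ => ((μ ^ b : ℝ) : ℂ)) (Ioi 0) :=
  Complex.continuous_ofReal.comp_continuousOn
    (continuousOn_id.rpow_const fun _ hμ => Or.inl (ne_of_gt hμ))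

variable {X : Type*} [NormedAddCommGroup X] [NormedSpace ℂ X]

theorem norm_rpow_smul {μ : ℝ} (hμ : 0 < μ) (b : ℝ) (x : X) :
    ‖((μ ^ b : ℝ) : ℂ) • x‖ = μ ^ b * ‖x‖ := by
  rw [norm_smul, Complex.norm_real, Real.norm_of_nonneg (Real.rpow_nonneg hμ.le b)]

theorem integrableOn_rpow_smul {g : ℝ → X} (hg : ContinuousOn g (Ioi 0)) {C b e : ℝ}
    (hb : -1 < b) (he : b - e < -1) (h0 : ∀ μ, 0 < μ → ‖g μ‖ ≤ C)
    (h1 : ∀ μ, 0 < μ → ‖g μ‖ ≤ C * μ ^ (-e)) :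
    IntegrableOn (fun μ : ℝ => ((μ ^ b : ℝ) : ℂ) • g μ) (Ioi 0) := by
  refine integrableOn_Ioi_of_norm_le_rpow (C := C) ((continuousOn_rpow_Ioi b).smul hg) hb he
    (fun μ hμ => ?_) fun μ hμ => ?_
  · rw [norm_rpow_smul hμ, mul_comm]
    exact mul_le_mul_of_nonneg_right (h0 μ hμ) (Real.rpow_nonneg hμ.le b)
  · rw [norm_rpow_smul hμ, sub_eq_add_neg, Real.rpow_add hμ]
    have := mul_le_mul_of_nonneg_left (h1 μ hμ) (Real.rpow_nonneg hμ.le b)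
    linarith

/-- Integration by parts against a power on the half-line. -/
theorem integral_rpow_smul_by_parts [CompleteSpace X] {h h' : ℝ → X}
    (hder : ∀ μ, 0 < μ → HasDerivAt h (h' μ) μ) (hcont : ContinuousOn h' (Ioi 0)) {C b e : ℝ}
    (hb0 : 0 < b) (hb1 : b < 1) (he : 1 - b < e) (h0 : ∀ μ, 0 < μ → ‖h μ‖ ≤ C)
    (h1 : ∀ μ, 0 < μ → ‖h μ‖ ≤ C * μ ^ (-e)) (h0' : ∀ μ, 0 < μ → ‖h' μ‖ ≤ C)
    (h1' : ∀ μ, 0 < μ → ‖h' μ‖ ≤ C * μ ^ (-(e + 1))) :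
    ((1 - b : ℝ) : ℂ) • ∫ μ in Ioi (0 : ℝ), ((μ ^ (-b) : ℝ) : ℂ) • h μ
      = -∫ μ in Ioi (0 : ℝ), ((μ ^ (1 - b) : ℝ) : ℂ) • h' μ := by
  have hch : ContinuousOn h (Ioi 0) := fun μ hμ => (hder μ hμ).continuousAt.continuousWithinAt
  have i1 : IntegrableOn (fun μ : ℝ => ((μ ^ (-b) : ℝ) : ℂ) • h μ) (Ioi 0) :=
    integrableOn_rpow_smul hch (by linarith) (by linarith) h0 h1
  have i2 : IntegrableOn (fun μ : ℝ => ((μ ^ (1 - b) : ℝ) : ℂ) • h' μ) (Ioi 0) :=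
    integrableOn_rpow_smul hcont (by linarith) (by linarith) h0' h1'
  have i1' := i1.smul ((1 - b : ℝ) : ℂ)
  -- F carries the boundary terms: it vanishes at 0 because b < 1 and h is bounded, and at ∞ because
  -- h decays with exponent e > 1 - b.
  set F : ℝ → X := fun μ => ((μ ^ (1 - b) : ℝ) : ℂ) • h μ with hF
  have hF0 : F 0 = 0 := by
    simp [hF, Real.zero_rpow (by linarith : (1 - b : ℝ) ≠ 0)]
  have hFd : ∀ μ ∈ Ioi (0 : ℝ), HasDerivAt F
      (((1 - b : ℝ) : ℂ) • (((μ ^ (-b) : ℝ) : ℂ) • h μ) + ((μ ^ (1 - b) : ℝ) : ℂ) • h' μ) μ := by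
    intro μ hμ
    have e1 := (Real.hasDerivAt_rpow_const (p := 1 - b) (Or.inl (ne_of_gt hμ))).ofReal_comp
    have e2 := e1.smul (hder μ hμ)
    refine e2.congr_deriv ?_
    rw [show 1 - b - 1 = -b by ring, smul_smul, add_comm]
    push_cast
    rfl
  have hFc : ContinuousWithinAt F (Ici 0) 0 := by
    rw [ContinuousWithinAt, hF0]
    have hl : Tendsto (fun μ : ℝ => C * μ ^ (1 - b)) (𝓝[Ici 0] 0) (𝓝 0) := by
      have : Continuous fun μ : ℝ => C * μ ^ (1 - b) :=
        continuous_const.mul (Real.continuous_rpow_const (by linarith))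
      have h2 := (this.tendsto 0).mono_left (nhdsWithin_le_nhds (s := Ici 0))
      simpa [Real.zero_rpow (by linarith : (1 - b : ℝ) ≠ 0)] using h2
    refine squeeze_zero_norm' ?_ hl
    filter_upwards [self_mem_nhdsWithin] with μ hμ
    rcases (mem_Ici.1 hμ).eq_or_lt with h' | h'
    · rw [← h', hF0, Real.zero_rpow (by linarith : (1 - b : ℝ) ≠ 0)]; simp
    · rw [hF, norm_rpow_smul h', mul_comm]
      exact mul_le_mul_of_nonneg_right (h0 μ h') (Real.rpow_nonneg h'.le _)
  have hFl : Tendsto F atTop (𝓝 0) := by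
    have hl : Tendsto (fun μ : ℝ => C * μ ^ (-(e - (1 - b)))) atTop (𝓝 0) := by
      simpa using (tendsto_rpow_neg_atTop (by linarith : 0 < e - (1 - b))).const_mul C
    refine squeeze_zero_norm' ?_ hl
    filter_upwards [eventually_gt_atTop (0 : ℝ)] with μ hμ
    rw [hF, norm_rpow_smul hμ, show -(e - (1 - b)) = (1 - b) + -e by ring, Real.rpow_add hμ]
    have := mul_le_mul_of_nonneg_left (h1 μ hμ) (Real.rpow_nonneg hμ.le (1 - b))
    linarith
  have key := integral_Ioi_of_hasDerivAt_of_tendsto hFc hFd (i1'.add i2) hFl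
  rw [hF0, sub_zero] at key
  have key2 := integral_add i1' i2
  rw [eq_neg_iff_add_eq_zero, ← integral_smul, ← key]
  exact key2.symm

/-! ### The Schur test. -/

/-- The kernel which is a power on either side of the diagonal, homogeneous of degree `-1`. -/
def powKernel (p q x ν : ℝ) : ℝ := if ν ≤ x then x ^ (-p - 1) * ν ^ p else x ^ (-q - 1) * ν ^ q

theorem measurable_powKernel (p q : ℝ) : Measurable fun z : ℝ × ℝ => powKernel p q z.1 z.2 := by
  unfold powKernel
  refine Measurable.ite (measurableSet_le measurable_snd measurable_fst) ?_ ?_ <;> fun_prop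

theorem powKernel_nonneg (p q : ℝ) {x ν : ℝ} (hx : 0 < x) (hν : 0 < ν) : 0 ≤ powKernel p q x ν := by
  unfold powKernel
  split_ifs <;> positivity

/-- By homogeneity of degree -1 the bound does not depend on x; p governs convergence at 0 and q at
∞. -/
theorem lintegral_powKernel_le {p q x : ℝ} (hx : 0 < x) (hp : -1 < p) (hq : q < -1) :
    ∫⁻ ν in Ioi (0 : ℝ), ENNReal.ofReal (powKernel p q x ν)
      ≤ ENNReal.ofReal (1 / (p + 1) + 1 / (-q - 1)) := by
  have hp' : 0 < p + 1 := by linarith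
  have hq' : 0 < -q - 1 := by linarith
  rw [← Ioc_union_Ioi_eq_Ioi hx.le,
    lintegral_union measurableSet_Ioi (Ioc_disjoint_Ioi le_rfl), ENNReal.ofReal_add (by positivity)
      (by positivity)]
  refine add_le_add ?_ ?_
  · have hi : IntegrableOn (fun ν : ℝ => x ^ (-p - 1) * ν ^ p) (Ioc 0 x) := by
      have := (intervalIntegral.intervalIntegrable_rpow' (a := 0) (b := x) hp).const_mul
        (x ^ (-p - 1))
      rwa [intervalIntegrable_iff_integrableOn_Ioc_of_le hx.le] at this
    have e1 : ∫⁻ ν in Ioc 0 x, ENNReal.ofReal (powKernel p q x ν)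
        = ∫⁻ ν in Ioc 0 x, ENNReal.ofReal (x ^ (-p - 1) * ν ^ p) := by
      refine setLIntegral_congr_fun measurableSet_Ioc fun ν hν => ?_
      simp only [powKernel, if_pos hν.2]
    rw [e1, ← ofReal_integral_eq_lintegral_ofReal hi
      ((ae_restrict_mem measurableSet_Ioc).mono fun ν hν => by
        have := hν.1; show (0 : ℝ) ≤ _; positivity), ← intervalIntegral.integral_of_le hx.le,
      intervalIntegral.integral_const_mul, integral_rpow (Or.inl hp)]
    refine ENNReal.ofReal_le_ofReal (le_of_eq ?_)
    rw [Real.zero_rpow hp'.ne', sub_zero, ← mul_div_assoc, ← Real.rpow_add hx]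
    simp
  · have hi : IntegrableOn (fun ν : ℝ => x ^ (-q - 1) * ν ^ q) (Ioi x) :=
      (integrableOn_Ioi_rpow_of_lt hq hx).const_mul _
    have e1 : ∫⁻ ν in Ioi x, ENNReal.ofReal (powKernel p q x ν)
        = ∫⁻ ν in Ioi x, ENNReal.ofReal (x ^ (-q - 1) * ν ^ q) := by
      refine setLIntegral_congr_fun measurableSet_Ioi fun ν hν => ?_
      simp only [powKernel, if_neg (not_le.2 (mem_Ioi.1 hν))]
    rw [e1, ← ofReal_integral_eq_lintegral_ofReal hi
      ((ae_restrict_mem measurableSet_Ioi).mono fun ν hν => by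
        have : 0 < ν := hx.trans hν
        show (0 : ℝ) ≤ _; positivity), integral_const_mul, integral_Ioi_rpow_of_lt hq hx]
    refine ENNReal.ofReal_le_ofReal (le_of_eq ?_)
    rw [← mul_div_assoc, mul_neg, ← Real.rpow_add hx]
    simp only [show -q - 1 + (q + 1) = 0 by ring, Real.rpow_zero]
    rw [show -q - 1 = -(q + 1) by ring, div_neg, neg_div]

/-- The pointwise inequality behind the Schur test. -/
theorem kernel_pointwise {γ μ ν N K P Q τ : ℝ} (hμ : 0 < μ) (hν : 0 < ν) (hτ : 0 < τ)
    (hP : 0 ≤ P) (hQ : 0 ≤ Q) (hK : 0 ≤ K)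
    (h1 : N * μ ≤ K * (√P * √Q)) (h2 : N * (√μ * √ν) ≤ K * (√P * √Q)) :
    μ ^ γ * ν ^ (-γ) * N ≤ K * (τ * P) * powKernel (-γ - 1 / 2) (-γ - 1) μ ν
      + K * (τ⁻¹ * Q) * powKernel (γ - 1) (γ - 3 / 2) ν μ := by
  -- Weighted arithmetic-geometric mean with the Schur weight √(μ/ν). The free factor τ balances the
  -- two sums later.
  have ham : √P * √Q * 1 ≤ τ * (√(μ / ν)) * P + τ⁻¹ * √(ν / μ) * Q := by
    set y := √(μ / ν) with hy
    have hy0 : 0 < y := Real.sqrt_pos.2 (by positivity)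
    have hy2 : √(ν / μ) = y⁻¹ := by rw [hy, ← Real.sqrt_inv, inv_div]
    have hPs := Real.sq_sqrt hP
    have hQs := Real.sq_sqrt hQ
    rw [hy2, ← hPs, ← hQs, Real.sqrt_sq (Real.sqrt_nonneg _), Real.sqrt_sq (Real.sqrt_nonneg _),
      ← mul_inv]
    set t := τ * y with ht
    have ht0 : 0 < t := by positivity
    set x := √P
    set z := √Q
    have e : t * x ^ 2 + t⁻¹ * z ^ 2 - 2 * (x * z) = t * (x - t⁻¹ * z) ^ 2 := by
      field_simp
      ring
    have : 0 ≤ t * (x - t⁻¹ * z) ^ 2 := by positivity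
    have hx : 0 ≤ x := Real.sqrt_nonneg _
    have hz : 0 ≤ z := Real.sqrt_nonneg _
    nlinarith [mul_nonneg hx hz]
  have main : ∀ κ : ℝ, 0 ≤ κ → N ≤ κ * (K * (√P * √Q)) →
      μ ^ γ * ν ^ (-γ) * N ≤ K * (τ * P) * (μ ^ γ * ν ^ (-γ) * κ * √(μ / ν))
        + K * (τ⁻¹ * Q) * (μ ^ γ * ν ^ (-γ) * κ * √(ν / μ)) := by
    intro κ hκ hN
    calc μ ^ γ * ν ^ (-γ) * N ≤ μ ^ γ * ν ^ (-γ) * (κ * (K * (√P * √Q))) := by gcongr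
      _ = μ ^ γ * ν ^ (-γ) * (κ * K) * (√P * √Q * 1) := by ring
      _ ≤ μ ^ γ * ν ^ (-γ) * (κ * K) * (τ * (√(μ / ν)) * P + τ⁻¹ * √(ν / μ) * Q) := by gcongr
      _ = _ := by ring
  have hs1 : √(μ / ν) = μ ^ (1 / 2 : ℝ) * ν ^ (-(1 / 2) : ℝ) := by
    rw [Real.sqrt_eq_rpow, Real.div_rpow hμ.le hν.le, Real.rpow_neg hν.le, div_eq_mul_inv]
  have hs2 : √(ν / μ) = ν ^ (1 / 2 : ℝ) * μ ^ (-(1 / 2) : ℝ) := by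
    rw [Real.sqrt_eq_rpow, Real.div_rpow hν.le hμ.le, Real.rpow_neg hμ.le, div_eq_mul_inv]
  -- The bound 1/μ is used for ν ≤ μ and 1/√(μν) for ν > μ. The diagonal is a case of its own
  -- because there both kernels take their `≤` branch, while off it exactly one of them does.
  rcases lt_trichotomy ν μ with hlt | heq | hgt
  · refine (main (μ ^ (-1 : ℝ)) (by positivity) ?_).trans (le_of_eq ?_)
    · rw [Real.rpow_neg_one, inv_mul_eq_div, le_div_iff₀ hμ]; exact h1
    · rw [powKernel, if_pos hlt.le, powKernel, if_neg (not_le.2 hlt), hs1, hs2]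
      congr 2
      · rw [show -(-γ - 1 / 2) - 1 = γ + -1 + 1 / 2 by ring,
          show -γ - 1 / 2 = -γ + -(1 / 2) by ring, Real.rpow_add hμ, Real.rpow_add hμ,
          Real.rpow_add hν]
        ring
      · rw [show -(γ - 3 / 2) - 1 = -γ + 1 / 2 by ring,
          show γ - 3 / 2 = γ + -1 + -(1 / 2) by ring, Real.rpow_add hμ, Real.rpow_add hμ,
          Real.rpow_add hν]
        ring
  · subst heq
    refine (main (ν ^ (-1 : ℝ)) (by positivity) ?_).trans (le_of_eq ?_)
    · rw [Real.rpow_neg_one, inv_mul_eq_div, le_div_iff₀ hμ]; exact h1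
    · rw [powKernel, if_pos le_rfl, powKernel, if_pos le_rfl, div_self hν.ne', Real.sqrt_one]
      simp only [mul_one, ← Real.rpow_add hν]
      congr 2 <;> (congr 1; ring)
  · refine (main (μ ^ (-(1 / 2) : ℝ) * ν ^ (-(1 / 2) : ℝ)) (by positivity) ?_).trans (le_of_eq ?_)
    · rw [Real.rpow_neg hμ.le, Real.rpow_neg hν.le, ← Real.sqrt_eq_rpow, ← Real.sqrt_eq_rpow,
        ← mul_inv, inv_mul_eq_div, le_div_iff₀ (by positivity)]
      exact h2
    · rw [powKernel, if_neg (not_le.2 hgt), powKernel, if_pos hgt.le, hs1, hs2]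
      congr 2
      · rw [show μ ^ (-(-γ - 1) - 1) = μ ^ (γ + -(1 / 2) + 1 / 2) by congr 1; ring,
          show ν ^ (-γ - 1) = ν ^ (-γ + -(1 / 2) + -(1 / 2)) by congr 1; ring,
          Real.rpow_add hμ, Real.rpow_add hμ, Real.rpow_add hν, Real.rpow_add hν]
        ring
      · rw [show ν ^ (-(γ - 1) - 1) = ν ^ (-γ + -(1 / 2) + 1 / 2) by congr 1; ring,
          show μ ^ (γ - 1) = μ ^ (γ + -(1 / 2) + -(1 / 2)) by congr 1; ring,
          Real.rpow_add hμ, Real.rpow_add hμ, Real.rpow_add hν, Real.rpow_add hν]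
        ring

/-- A Schur test for the kernel `μ ^ γ ν ^ (-γ) min (1 / μ) (1 / √(μ ν))`, `0 < γ < 1 / 2`. -/
theorem lintegral_kernel_le {γ K A B : ℝ} (hγ0 : 0 < γ) (hγ1 : γ < 1 / 2) (hK : 0 ≤ K)
    (hA : 0 ≤ A) (hB : 0 ≤ B) {P Q : ℝ → ℝ} {N : ℝ → ℝ → ℝ}
    (hPc : ContinuousOn P (Ioi 0)) (hQc : ContinuousOn Q (Ioi 0))
    (hP0 : ∀ μ, 0 < μ → 0 ≤ P μ) (hQ0 : ∀ μ, 0 < μ → 0 ≤ Q μ)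
    (hP : ∫⁻ μ in Ioi (0 : ℝ), ENNReal.ofReal (P μ) ≤ ENNReal.ofReal (A ^ 2))
    (hQ : ∫⁻ μ in Ioi (0 : ℝ), ENNReal.ofReal (Q μ) ≤ ENNReal.ofReal (B ^ 2))
    (h1 : ∀ μ ν, 0 < μ → 0 < ν → N μ ν * μ ≤ K * (√(P μ) * √(Q ν)))
    (h2 : ∀ μ ν, 0 < μ → 0 < ν → N μ ν * (√μ * √ν) ≤ K * (√(P μ) * √(Q ν))) :
    ∫⁻ μ in Ioi (0 : ℝ), ∫⁻ ν in Ioi (0 : ℝ), ENNReal.ofReal (μ ^ γ * ν ^ (-γ) * N μ ν)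
      ≤ ENNReal.ofReal (2 * K * (1 / (1 / 2 - γ) + 1 / γ) * (A * B)) := by
  -- Bound for the row and for the column integrals: the exponents of the two kernels give the same
  -- two terms, in opposite order. Here 0 < γ < 1/2 is needed.
  set D : ℝ := 1 / (1 / 2 - γ) + 1 / γ with hD
  have hD0 : 0 ≤ D := by
    have : 0 < 1 / 2 - γ := by linarith
    positivity
  have mP : AEMeasurable (fun μ => ENNReal.ofReal (P μ)) (volume.restrict (Ioi (0 : ℝ))) :=
    (hPc.aemeasurable measurableSet_Ioi).ennreal_ofReal
  have mQ : AEMeasurable (fun μ => ENNReal.ofReal (Q μ)) (volume.restrict (Ioi (0 : ℝ))) :=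
    (hQc.aemeasurable measurableSet_Ioi).ennreal_ofReal
  have k1 : ∀ μ, 0 < μ → ∫⁻ ν in Ioi (0 : ℝ),
      ENNReal.ofReal (powKernel (-γ - 1 / 2) (-γ - 1) μ ν) ≤ ENNReal.ofReal D := by
    intro μ hμ
    refine (lintegral_powKernel_le hμ (by linarith) (by linarith)).trans
      (ENNReal.ofReal_le_ofReal (le_of_eq ?_))
    rw [hD]; congr 2 <;> ring
  have k2 : ∀ ν, 0 < ν → ∫⁻ μ in Ioi (0 : ℝ),
      ENNReal.ofReal (powKernel (γ - 1) (γ - 3 / 2) ν μ) ≤ ENNReal.ofReal D := by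
    intro μ hμ
    refine (lintegral_powKernel_le hμ (by linarith) (by linarith)).trans
      (ENNReal.ofReal_le_ofReal (le_of_eq ?_))
    rw [hD, add_comm]; congr 2 <;> ring
  have step : ∀ τ : ℝ, 0 < τ →
      ∫⁻ μ in Ioi (0 : ℝ), ∫⁻ ν in Ioi (0 : ℝ), ENNReal.ofReal (μ ^ γ * ν ^ (-γ) * N μ ν)
        ≤ ENNReal.ofReal (K * τ * D * A ^ 2) + ENNReal.ofReal (K * τ⁻¹ * D * B ^ 2) := by
    intro τ hτ
    have mk1 : Measurable fun z : ℝ × ℝ =>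
        ENNReal.ofReal (powKernel (-γ - 1 / 2) (-γ - 1) z.1 z.2) :=
      (measurable_powKernel _ _).ennreal_ofReal
    have mk2 : Measurable fun z : ℝ × ℝ =>
        ENNReal.ofReal (powKernel (γ - 1) (γ - 3 / 2) z.2 z.1) :=
      ((measurable_powKernel (γ - 1) (γ - 3 / 2)).comp measurable_swap).ennreal_ofReal
    calc ∫⁻ μ in Ioi (0 : ℝ), ∫⁻ ν in Ioi (0 : ℝ), ENNReal.ofReal (μ ^ γ * ν ^ (-γ) * N μ ν)
        ≤ ∫⁻ μ in Ioi (0 : ℝ), ∫⁻ ν in Ioi (0 : ℝ),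
            (ENNReal.ofReal (K * τ) * (ENNReal.ofReal (P μ) *
              ENNReal.ofReal (powKernel (-γ - 1 / 2) (-γ - 1) μ ν))
            + ENNReal.ofReal (K * τ⁻¹) * (ENNReal.ofReal (Q ν) *
              ENNReal.ofReal (powKernel (γ - 1) (γ - 3 / 2) ν μ))) := by
          refine setLIntegral_mono' measurableSet_Ioi fun μ hμ =>
            setLIntegral_mono' measurableSet_Ioi fun ν hν => ?_
          have hμ' : 0 < μ := hμ
          have hν' : 0 < ν := hν
          have n1 := powKernel_nonneg (-γ - 1 / 2) (-γ - 1) hμ' hν'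
          have n2 := powKernel_nonneg (γ - 1) (γ - 3 / 2) hν' hμ'
          have n3 := hP0 μ hμ
          have n4 := hQ0 ν hν
          rw [← ENNReal.ofReal_mul n3, ← ENNReal.ofReal_mul (by positivity),
            ← ENNReal.ofReal_mul n4, ← ENNReal.ofReal_mul (by positivity),
            ← ENNReal.ofReal_add (by positivity) (by positivity)]
          refine ENNReal.ofReal_le_ofReal ((kernel_pointwise hμ' hν' hτ n3 n4 hK (h1 μ ν hμ' hν')
            (h2 μ ν hμ' hν')).trans (le_of_eq ?_))
          ring
      _ = (∫⁻ μ in Ioi (0 : ℝ), ∫⁻ ν in Ioi (0 : ℝ),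
            ENNReal.ofReal (K * τ) * (ENNReal.ofReal (P μ) *
              ENNReal.ofReal (powKernel (-γ - 1 / 2) (-γ - 1) μ ν)))
          + ∫⁻ μ in Ioi (0 : ℝ), ∫⁻ ν in Ioi (0 : ℝ), ENNReal.ofReal (K * τ⁻¹) *
            (ENNReal.ofReal (Q ν) * ENNReal.ofReal (powKernel (γ - 1) (γ - 3 / 2) ν μ)) := by
          rw [← lintegral_add_left']
          · refine lintegral_congr fun μ => ?_
            rw [lintegral_add_left]
            exact ((mk1.comp measurable_prodMk_left).const_mul _).const_mul _
          · refine AEMeasurable.congr (f := fun μ => ENNReal.ofReal (K * τ) * (ENNReal.ofReal (P μ) *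
              ∫⁻ ν in Ioi (0 : ℝ), ENNReal.ofReal (powKernel (-γ - 1 / 2) (-γ - 1) μ ν))) ?_ ?_
            · exact (mP.mul (mk1.lintegral_prod_right').aemeasurable).const_mul _
            · refine ae_of_all _ fun μ => ?_
              have mm : Measurable fun ν => ENNReal.ofReal (powKernel (-γ - 1 / 2) (-γ - 1) μ ν) :=
                mk1.comp (measurable_prodMk_left (x := μ))
              simp only
              rw [lintegral_const_mul _ (mm.const_mul _), lintegral_const_mul _ mm]
      _ ≤ _ := by
          refine add_le_add ?_ ?_
          · calc ∫⁻ μ in Ioi (0 : ℝ), ∫⁻ ν in Ioi (0 : ℝ),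
                  ENNReal.ofReal (K * τ) * (ENNReal.ofReal (P μ) *
                    ENNReal.ofReal (powKernel (-γ - 1 / 2) (-γ - 1) μ ν))
                ≤ ∫⁻ μ in Ioi (0 : ℝ), ENNReal.ofReal (K * τ) * (ENNReal.ofReal (P μ)
                    * ENNReal.ofReal D) := by
                  refine setLIntegral_mono' measurableSet_Ioi fun μ hμ => ?_
                  have mm : Measurable fun ν => ENNReal.ofReal (powKernel (-γ - 1 / 2) (-γ - 1) μ ν) :=
                mk1.comp (measurable_prodMk_left (x := μ))
                  rw [lintegral_const_mul _ (mm.const_mul _), lintegral_const_mul _ mm]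
                  gcongr
                  exact k1 μ hμ
              _ = ENNReal.ofReal (K * τ) * ((∫⁻ μ in Ioi (0 : ℝ), ENNReal.ofReal (P μ))
                    * ENNReal.ofReal D) := by
                  rw [lintegral_const_mul'' _ (mP.mul_const _), lintegral_mul_const'' _ mP]
              _ ≤ ENNReal.ofReal (K * τ) * (ENNReal.ofReal (A ^ 2) * ENNReal.ofReal D) := by gcongr
              _ = ENNReal.ofReal (K * τ * D * A ^ 2) := by
                  rw [← ENNReal.ofReal_mul (by positivity), ← ENNReal.ofReal_mul (by positivity)]
                  congr 1; ring
          · calc ∫⁻ μ in Ioi (0 : ℝ), ∫⁻ ν in Ioi (0 : ℝ),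
                  ENNReal.ofReal (K * τ⁻¹) * (ENNReal.ofReal (Q ν) *
                    ENNReal.ofReal (powKernel (γ - 1) (γ - 3 / 2) ν μ))
                = ∫⁻ ν in Ioi (0 : ℝ), ∫⁻ μ in Ioi (0 : ℝ),
                  ENNReal.ofReal (K * τ⁻¹) * (ENNReal.ofReal (Q ν) *
                    ENNReal.ofReal (powKernel (γ - 1) (γ - 3 / 2) ν μ)) := by
                  refine lintegral_lintegral_swap ?_
                  refine AEMeasurable.const_mul (AEMeasurable.mul ?_ mk2.aemeasurable) _
                  exact mQ.comp_quasiMeasurePreserving Measure.quasiMeasurePreserving_snd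
              _ ≤ ∫⁻ ν in Ioi (0 : ℝ), ENNReal.ofReal (K * τ⁻¹) * (ENNReal.ofReal (Q ν)
                    * ENNReal.ofReal D) := by
                  refine setLIntegral_mono' measurableSet_Ioi fun ν hν => ?_
                  have mm : Measurable fun μ => ENNReal.ofReal (powKernel (γ - 1) (γ - 3 / 2) ν μ) :=
                    mk2.comp (measurable_prodMk_right (y := ν))
                  rw [lintegral_const_mul _ (mm.const_mul _), lintegral_const_mul _ mm]
                  gcongr
                  exact k2 ν hν
              _ = ENNReal.ofReal (K * τ⁻¹) * ((∫⁻ ν in Ioi (0 : ℝ), ENNReal.ofReal (Q ν))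
                    * ENNReal.ofReal D) := by
                  rw [lintegral_const_mul'' _ (mQ.mul_const _), lintegral_mul_const'' _ mQ]
              _ ≤ ENNReal.ofReal (K * τ⁻¹) * (ENNReal.ofReal (B ^ 2) * ENNReal.ofReal D) := by
                  gcongr
              _ = ENNReal.ofReal (K * τ⁻¹ * D * B ^ 2) := by
                  rw [← ENNReal.ofReal_mul (by positivity), ← ENNReal.ofReal_mul (by positivity)]
                  congr 1; ring
  -- The choice τ = B/A would balance the two terms. The shift by ε keeps it meaningful when A or B
  -- is 0, and is removed by a limit.
  have hε : ∀ ε : ℝ, 0 < ε →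
      ∫⁻ μ in Ioi (0 : ℝ), ∫⁻ ν in Ioi (0 : ℝ), ENNReal.ofReal (μ ^ γ * ν ^ (-γ) * N μ ν)
        ≤ ENNReal.ofReal (2 * K * D * ((A + ε) * (B + ε))) := by
    intro ε hε
    have hA' : 0 < A + ε := by linarith
    have hB' : 0 < B + ε := by linarith
    refine (step ((B + ε) / (A + ε)) (by positivity)).trans ?_
    rw [← ENNReal.ofReal_add (by positivity) (by positivity)]
    refine ENNReal.ofReal_le_ofReal ?_
    calc K * ((B + ε) / (A + ε)) * D * A ^ 2 + K * ((B + ε) / (A + ε))⁻¹ * D * B ^ 2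
        ≤ K * ((B + ε) / (A + ε)) * D * (A + ε) ^ 2
          + K * ((B + ε) / (A + ε))⁻¹ * D * (B + ε) ^ 2 := by gcongr <;> linarith
      _ = 2 * K * D * ((A + ε) * (B + ε)) := by
        field_simp
        ring
  have hlim : Tendsto (fun ε : ℝ => ENNReal.ofReal (2 * K * D * ((A + ε) * (B + ε)))) (𝓝[>] 0)
      (𝓝 (ENNReal.ofReal (2 * K * D * (A * B)))) := by
    have : Continuous fun ε : ℝ => ENNReal.ofReal (2 * K * D * ((A + ε) * (B + ε))) :=
      ENNReal.continuous_ofReal.comp (by fun_prop)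
    have h := (this.tendsto 0).mono_left (nhdsWithin_le_nhds (s := Ioi 0))
    simpa using h
  exact ge_of_tendsto hlim (eventually_nhdsWithin_of_forall fun ε h => hε ε h)

end HalfLine

/-! ### Composition of Balakrishnan integrals. -/

section PowerComposition

open Filter Topology Set

variable {V H : Type*} [NormedAddCommGroup V] [InnerProductSpace ℂ V]
  [NormedAddCommGroup H] [InnerProductSpace ℂ H] [CompleteSpace V] [CompleteSpace H]

/-- The Balakrishnan integral without the normalising factor. -/
def balakrishnan (j : V →L[ℂ] H) (T : V →L[ℂ] V) (β : ℝ) (f : H) : H :=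
  ∫ μ in Ioi (0 : ℝ), ((μ ^ (-β) : ℝ) : ℂ) • resH j T μ f

/-- The integral `∫_0^∞ s ^ (-β) log s / (s - 1) ds`. -/
def logIntegral (β : ℝ) : ℂ :=
  ∫ s in Ioi (0 : ℝ), ((s ^ (-β) : ℝ) : ℂ) * (((s - 1)⁻¹ * Real.log s : ℝ) : ℂ)

namespace IsRegAccretive

variable {j : V →L[ℂ] H} {a : V → V → ℂ} {T : V →L[ℂ] V} {c : ℝ}

/-- The uniform bound and the 1/μ bound interpolate to every exponent e ∈ [0, 1], with one constant;
the freedom in e is what the Fubini argument uses. -/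
theorem exists_resH_bound (h : IsRegAccretive j a T c) :
    ∃ C : ℝ, 1 ≤ C ∧ (∀ μ f, 0 ≤ μ → ‖resH j T μ f‖ ≤ C * ‖f‖) ∧
      ∀ (μ : ℝ) (f : H) (e : ℝ), 0 < μ → 0 ≤ e → e ≤ 1 → ‖resH j T μ f‖ ≤ C * μ ^ (-e) * ‖f‖ := by
  have hb1 : ∀ μ f, 0 ≤ μ → ‖resH j T μ f‖ ≤ max 1 (‖j‖ * ‖j‖ / c) * ‖f‖ := fun μ f hμ =>
    (h.norm_resH_le' hμ f).trans (mul_le_mul_of_nonneg_right (le_max_right _ _) (norm_nonneg _))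
  refine ⟨max 1 (‖j‖ * ‖j‖ / c), le_max_left _ _, hb1, fun μ f e hμ he0 he1 => ?_⟩
  have hC : (0 : ℝ) ≤ max 1 (‖j‖ * ‖j‖ / c) := zero_le_one.trans (le_max_left _ _)
  rcases le_total μ 1 with h1 | h1
  · refine (hb1 μ f hμ.le).trans (mul_le_mul_of_nonneg_right ?_ (norm_nonneg _))
    exact le_mul_of_one_le_right hC (Real.one_le_rpow_of_pos_of_le_one_of_nonpos hμ h1 (by linarith))
  · have h2 : ‖resH j T μ f‖ ≤ μ⁻¹ * ‖f‖ := by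
      rw [inv_mul_eq_div, le_div_iff₀ hμ, mul_comm]; exact h.norm_resH_le hμ.le f
    refine h2.trans (mul_le_mul_of_nonneg_right ?_ (norm_nonneg _))
    rw [← Real.rpow_neg_one]
    refine (Real.rpow_le_rpow_of_exponent_le h1 (by linarith : (-1 : ℝ) ≤ -e)).trans ?_
    exact le_mul_of_one_le_left (by positivity) (le_max_left _ _)

theorem continuousOn_resH_Ioi (h : IsRegAccretive j a T c) (f : H) :
    ContinuousOn (fun μ => resH j T μ f) (Ioi 0) :=
  (h.continuousOn_resH f).mono Ioi_subset_Ici_self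

theorem integrableOn_balakrishnan (h : IsRegAccretive j a T c) {β : ℝ} (h0 : 0 < β) (h1 : β < 1)
    (f : H) : IntegrableOn (fun μ : ℝ => ((μ ^ (-β) : ℝ) : ℂ) • resH j T μ f) (Ioi 0) := by
  obtain ⟨C, hC, hb, hb'⟩ := h.exists_resH_bound
  refine integrableOn_rpow_smul (h.continuousOn_resH_Ioi f) (C := C * ‖f‖) (e := 1)
    (by linarith) (by linarith) (fun μ hμ => hb μ f hμ.le) fun μ hμ => ?_
  have := hb' μ f 1 hμ zero_le_one le_rfl
  linarith

theorem map_balakrishnan (h : IsRegAccretive j a T c) {β : ℝ} (h0 : 0 < β) (h1 : β < 1)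
    (L : H →L[ℂ] H) (f : H) : L (balakrishnan j T β f)
      = ∫ μ in Ioi (0 : ℝ), ((μ ^ (-β) : ℝ) : ℂ) • L (resH j T μ f) := by
  rw [balakrishnan, ← ContinuousLinearMap.integral_comp_comm L (h.integrableOn_balakrishnan h0 h1 f)]
  simp only [map_smul]

theorem resH_comm (h : IsRegAccretive j a T c) {μ ν : ℝ} (hμ : 0 ≤ μ) (hν : 0 ≤ ν) (f : H) :
    resH j T μ (resH j T ν f) = resH j T ν (resH j T μ f) := by
  rcases eq_or_ne μ ν with rfl | hne
  · rfl
  have h1 := h.resH_sub hμ hν f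
  have h2 := h.resH_sub hν hμ f
  have hz : ((ν - μ : ℝ) : ℂ) ≠ 0 := Complex.ofReal_ne_zero.2 (sub_ne_zero.2 hne.symm)
  have h3 : ((ν - μ : ℝ) : ℂ) • (resH j T μ (resH j T ν f) - resH j T ν (resH j T μ f)) = 0 := by
    rw [smul_sub, ← h1, show ((ν - μ : ℝ) : ℂ) = -((μ - ν : ℝ) : ℂ) by push_cast; ring, neg_smul,
      ← h2]
    abel
  exact sub_eq_zero.1 ((smul_eq_zero.1 h3).resolve_left hz)

theorem continuousOn_resH_resH (h : IsRegAccretive j a T c) (f : H) :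
    ContinuousOn (fun z : ℝ × ℝ => resH j T z.1 (resH j T (z.1 * z.2) f))
      (Ioi 0 ×ˢ Ioi 0) := by
  refine h.continuousOn_resH_comp continuousOn_fst ?_ fun z hz => le_of_lt hz.1
  exact h.continuousOn_resH_comp (continuousOn_fst.mul continuousOn_snd) continuousOn_const
    fun z hz => (mul_pos (mem_Ioi.1 hz.1) (mem_Ioi.1 hz.2)).le

theorem tendsto_resH_atTop (h : IsRegAccretive j a T c) (f : H) :
    Tendsto (fun μ => resH j T μ f) atTop (𝓝 0) := by
  have hl : Tendsto (fun μ : ℝ => μ⁻¹ * ‖f‖) atTop (𝓝 0) := by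
    simpa using tendsto_inv_atTop_zero.mul_const ‖f‖
  refine squeeze_zero_norm' ?_ hl
  filter_upwards [eventually_gt_atTop (0 : ℝ)] with μ hμ
  rw [inv_mul_eq_div, le_div_iff₀ hμ, mul_comm]
  exact h.norm_resH_le hμ.le f

/-- The Frullani integral of the resolvent. -/
theorem integral_resH_resH (h : IsRegAccretive j a T c) {s : ℝ} (hs : 0 < s) (hs1 : s ≠ 1)
    (f : H) : ∫ ν in Ioi (0 : ℝ), resH j T ν (resH j T (ν * s) f)
      = (((s - 1)⁻¹ * Real.log s : ℝ) : ℂ) • resH j T 0 f := by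
  obtain ⟨C, hC, hb, hb'⟩ := h.exists_resH_bound
  have hne : s - 1 ≠ 0 := sub_ne_zero.2 hs1
  -- The resolvent identity turns the product into a Frullani difference quotient.
  have hid : ∀ ν, 0 < ν → resH j T ν (resH j T (ν * s) f)
      = (s - 1)⁻¹ • (ν⁻¹ • (resH j T (1 * ν) f - resH j T (s * ν) f)) := by
    intro ν hν
    rw [one_mul, mul_comm s ν, h.resH_sub hν.le (mul_pos hν hs).le, Complex.coe_smul, smul_smul,
      smul_smul, show ν * s - ν = (s - 1) * ν by ring,
      show (s - 1)⁻¹ * ν⁻¹ * ((s - 1) * ν) = 1 by field_simp, one_smul]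
  have hcont : ContinuousOn (fun ν : ℝ => resH j T ν (resH j T (ν * s) f)) (Ioi 0) :=
    (h.continuousOn_resH_resH f).comp (f := fun ν : ℝ => (ν, s))
      (by fun_prop) fun ν hν => ⟨hν, hs⟩
  have hint : IntegrableOn (fun ν : ℝ => resH j T ν (resH j T (ν * s) f)) (Ioi 0) := by
    refine integrableOn_Ioi_of_norm_le_rpow hcont (C := max (C * (C * ‖f‖)) (C * (C * s⁻¹ * ‖f‖)))
      (p := 0) (q := -2) (by norm_num) (by norm_num) (fun ν hν => ?_) fun ν hν => ?_
    · rw [Real.rpow_zero, mul_one]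
      refine le_trans ?_ (le_max_left _ _)
      refine (hb ν _ hν.le).trans ?_
      gcongr
      exact hb _ f (mul_pos hν hs).le
    · refine le_trans ?_ (mul_le_mul_of_nonneg_right (le_max_right _ _) (by positivity))
      refine (hb' ν _ 1 hν zero_le_one le_rfl).trans ?_
      refine (mul_le_mul_of_nonneg_left (hb' (ν * s) f 1 (mul_pos hν hs) zero_le_one le_rfl)
        (by positivity)).trans (le_of_eq ?_)
      rw [Real.rpow_neg_one, Real.rpow_neg_one, Real.rpow_neg hν.le, Real.rpow_two]
      field_simp
  have hint2 : IntegrableOn (fun ν : ℝ => ν⁻¹ • (resH j T (1 * ν) f - resH j T (s * ν) f))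
      (Ioi 0) := by
    have := hint.smul (s - 1)
    refine IntegrableOn.congr_fun this (fun ν hν => ?_) measurableSet_Ioi
    simp only [Pi.smul_apply]
    rw [hid ν hν, smul_smul, mul_inv_cancel₀ hne, one_smul]
  have hL : Tendsto (fun μ => resH j T μ f) (𝓝[>] 0) (𝓝 (resH j T 0 f)) :=
    (h.continuousOn_resH f 0 self_mem_Ici).tendsto.mono_left
      (nhdsWithin_mono 0 Ioi_subset_Ici_self)
  have hF := Frullani.integral_Ioi_eq
    ((h.continuousOn_resH_Ioi f).locallyIntegrableOn measurableSet_Ioi) one_pos hs hL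
    (h.tendsto_resH_atTop f) hint2
  rw [setIntegral_congr_fun measurableSet_Ioi (fun ν hν => hid ν hν), integral_smul, hF, div_one,
    sub_zero, smul_smul, Complex.coe_smul]

/-- The composition of the powers `-γ` and `γ - 1` is a multiple of the solution operator. -/
theorem balakrishnan_comp (h : IsRegAccretive j a T c) {γ : ℝ} (h0 : 0 < γ) (h1 : γ < 1) (f : H) :
    balakrishnan j T γ (balakrishnan j T (1 - γ) f) = logIntegral (1 - γ) • resH j T 0 f := by
  obtain ⟨C, hC, hb, hb'⟩ := h.exists_resH_bound
  set β := 1 - γ with hβ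
  have hβ0 : 0 < β := by linarith
  have hβ1 : β < 1 := by linarith
  have hC0 : 0 ≤ C := zero_le_one.trans hC
  -- Substitution μ = ν s in the inner integral. All powers of ν cancel because γ + β = 1, so after
  -- exchanging the integrals only the Frullani integral in ν remains.
  have inner_eq : ∀ ν, 0 < ν → ((ν ^ (-γ) : ℝ) : ℂ) • resH j T ν (balakrishnan j T β f)
      = ∫ s in Ioi (0 : ℝ), ((s ^ (-β) : ℝ) : ℂ) • resH j T ν (resH j T (ν * s) f) := by
    intro ν hν
    rw [h.map_balakrishnan hβ0 hβ1 (resH j T ν) f]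
    have e := integral_comp_mul_left_Ioi'
      (fun μ : ℝ => ((μ ^ (-β) : ℝ) : ℂ) • resH j T ν (resH j T μ f)) 0 hν
    rw [mul_zero] at e
    rw [← e, ← Complex.coe_smul, smul_smul, ← integral_smul]
    refine setIntegral_congr_fun measurableSet_Ioi fun s hs => ?_
    have hs' : 0 < s := hs
    rw [smul_smul, ← Complex.ofReal_mul]
    congr 2
    rw [Real.mul_rpow hν.le hs'.le]
    have : ν ^ (-γ) * ν * ν ^ (-β) = 1 := by
      nth_rewrite 2 [← Real.rpow_one ν]
      rw [← Real.rpow_add hν, ← Real.rpow_add hν, show -γ + 1 + -β = 0 by rw [hβ]; ring,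
        Real.rpow_zero]
    rw [← Complex.ofReal_mul, ← mul_assoc, this, one_mul]
  have hprod : Integrable (Function.uncurry fun (ν s : ℝ) =>
      ((s ^ (-β) : ℝ) : ℂ) • resH j T ν (resH j T (ν * s) f))
      ((volume.restrict (Ioi 0)).prod (volume.restrict (Ioi 0))) := by
    -- Bounding R_{νs} by (νs)^(-e) leaves s^(-β-e). The exponent e₁ gives β + e₁ < 1, integrable at
    -- 0, and e₂ gives β + e₂ > 1, integrable at ∞. The singularity ν^(-e) is integrable at 0 since
    -- e < 1, and the factor min(1, 1/ν) from R_ν supplies the decay at ∞.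
    set e₁ : ℝ := (1 - β) / 2 with he₁
    set e₂ : ℝ := 1 - β / 2 with he₂
    set B : ℝ → ℝ := fun ν => min 1 ν⁻¹ with hB
    have hBc : ContinuousOn B (Ioi 0) :=
      continuousOn_const.inf (continuousOn_inv₀.mono fun ν hν => ne_of_gt hν)
    have hBpos : ∀ ν, 0 < ν → 0 < B ν := fun ν hν => lt_min one_pos (inv_pos.2 hν)
    have hM : ∀ e : ℝ, 0 < e → e < 1 → IntegrableOn (fun ν : ℝ => B ν * ν ^ (-e)) (Ioi 0) := by
      intro e he0 he1
      refine integrableOn_Ioi_of_norm_le_rpow (C := 1) (p := -e) (q := -1 - e)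
        (hBc.mul (continuousOn_id.rpow_const fun _ hμ => Or.inl (ne_of_gt hμ)))
        (by linarith) (by linarith) (fun ν hν => ?_) fun ν hν => ?_
      · have := hBpos ν hν
        rw [Real.norm_of_nonneg (by positivity)]
        exact mul_le_mul_of_nonneg_right (min_le_left _ _) (by positivity)
      · have := hBpos ν hν
        rw [Real.norm_of_nonneg (by positivity), sub_eq_add_neg, Real.rpow_add hν,
          Real.rpow_neg_one, one_mul]
        exact mul_le_mul_of_nonneg_right (min_le_right _ _) (by positivity)
    set G : ℝ → ℝ := fun s => min (s ^ (-β - e₁)) (s ^ (-β - e₂)) with hG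
    have hGi : IntegrableOn G (Ioi 0) := by
      refine integrableOn_Ioi_of_norm_le_rpow (C := 1) (p := -β - e₁) (q := -β - e₂)
        ((continuousOn_id.rpow_const fun _ hμ => Or.inl (ne_of_gt hμ)).inf
          (continuousOn_id.rpow_const fun _ hμ => Or.inl (ne_of_gt hμ)))
        (by linarith) (by linarith) (fun s hs => ?_) fun s hs => ?_
      · rw [Real.norm_of_nonneg (by positivity), one_mul]; exact min_le_left _ _
      · rw [Real.norm_of_nonneg (by positivity), one_mul]; exact min_le_right _ _
    have hMi := ((hM e₁ (by linarith) (by linarith)).add (hM e₂ (by linarith) (by linarith)))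
    have hdom := (hMi.mul_prod hGi).const_mul (C * C * ‖f‖)
    have hcont : ContinuousOn (Function.uncurry fun (ν s : ℝ) =>
        ((s ^ (-β) : ℝ) : ℂ) • resH j T ν (resH j T (ν * s) f)) (Ioi 0 ×ˢ Ioi 0) :=
      ((continuousOn_rpow_Ioi (-β)).comp continuousOn_snd fun z hz => hz.2).smul
        (h.continuousOn_resH_resH f)
    have hmeas : AEStronglyMeasurable (Function.uncurry fun (ν s : ℝ) =>
        ((s ^ (-β) : ℝ) : ℂ) • resH j T ν (resH j T (ν * s) f))
        ((volume.restrict (Ioi 0)).prod (volume.restrict (Ioi 0))) := by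
      rw [Measure.prod_restrict]
      exact hcont.aestronglyMeasurable (measurableSet_Ioi.prod measurableSet_Ioi)
    refine Integrable.mono' hdom hmeas ?_
    rw [Measure.prod_restrict]
    refine (ae_restrict_mem (measurableSet_Ioi.prod measurableSet_Ioi)).mono ?_
    rintro ⟨ν, s⟩ ⟨hν, hs⟩
    have hν' : 0 < ν := hν
    have hs' : 0 < s := hs
    have hBν := hBpos ν hν
    have est : ∀ e : ℝ, 0 ≤ e → e ≤ 1 →
        ‖((s ^ (-β) : ℝ) : ℂ) • resH j T ν (resH j T (ν * s) f)‖
          ≤ C * C * ‖f‖ * (B ν * ν ^ (-e) * s ^ (-β - e)) := by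
      intro e he0 he1
      have hB' : ∀ g : H, ‖resH j T ν g‖ ≤ C * B ν * ‖g‖ := by
        intro g
        rcases min_choice (1 : ℝ) ν⁻¹ with hm | hm
        · rw [hB]; simp only; rw [hm, mul_one]; exact hb ν g hν'.le
        · rw [hB]; simp only
          rw [hm, ← Real.rpow_neg_one]; exact hb' ν g 1 hν' zero_le_one le_rfl
      rw [norm_rpow_smul hs']
      calc s ^ (-β) * ‖resH j T ν (resH j T (ν * s) f)‖
          ≤ s ^ (-β) * (C * B ν * (C * (ν * s) ^ (-e) * ‖f‖)) := by
            gcongr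
            refine (hB' _).trans ?_
            gcongr
            exact hb' _ f e (mul_pos hν' hs') he0 he1
        _ = _ := by
            rw [Real.mul_rpow hν'.le hs'.le, sub_eq_add_neg, Real.rpow_add hs']
            ring
    show ‖((s ^ (-β) : ℝ) : ℂ) • resH j T ν (resH j T (ν * s) f)‖
      ≤ C * C * ‖f‖ * ((B ν * ν ^ (-e₁) + B ν * ν ^ (-e₂)) * G s)
    rcases min_choice (s ^ (-β - e₁)) (s ^ (-β - e₂)) with hm | hm
    · refine (est e₁ (by linarith) (by linarith)).trans ?_
      rw [hG]; simp only; rw [hm]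
      gcongr
      exact le_add_of_nonneg_right (by positivity)
    · refine (est e₂ (by linarith) (by linarith)).trans ?_
      rw [hG]; simp only; rw [hm]
      gcongr
      exact le_add_of_nonneg_left (by positivity)
  calc balakrishnan j T γ (balakrishnan j T β f)
      = ∫ ν in Ioi (0 : ℝ), ∫ s in Ioi (0 : ℝ),
          ((s ^ (-β) : ℝ) : ℂ) • resH j T ν (resH j T (ν * s) f) :=
        setIntegral_congr_fun measurableSet_Ioi fun ν hν => inner_eq ν hν
    _ = ∫ s in Ioi (0 : ℝ), ∫ ν in Ioi (0 : ℝ),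
          ((s ^ (-β) : ℝ) : ℂ) • resH j T ν (resH j T (ν * s) f) := integral_integral_swap hprod
    _ = ∫ s in Ioi (0 : ℝ), (((s ^ (-β) : ℝ) : ℂ) * (((s - 1)⁻¹ * Real.log s : ℝ) : ℂ))
          • resH j T 0 f := by
        refine integral_congr_ae ?_
        have hne : ∀ᵐ s ∂(volume.restrict (Ioi (0 : ℝ))), s ≠ 1 :=
          ae_restrict_of_ae (Measure.ae_ne volume 1)
        filter_upwards [ae_restrict_mem measurableSet_Ioi, hne] with s hs hs1
        rw [integral_smul, h.integral_resH_resH hs hs1, smul_smul]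
    _ = logIntegral β • resH j T 0 f := by
        rw [integral_smul_const, logIntegral]

end IsRegAccretive

theorem isRegAccretive_id : IsRegAccretive (ContinuousLinearMap.id ℂ ℂ) (fun u v : ℂ => ⟪v, u⟫_ℂ)
    (ContinuousLinearMap.id ℂ ℂ) 1 where
  pos := one_pos
  repr _ _ := rfl
  coercive v := by
    rw [one_mul]
    exact (inner_self_eq_norm_sq (𝕜 := ℂ) v).ge
  dense := Function.Surjective.denseRange fun x => ⟨x, rfl⟩

/-- The constant in `balakrishnan_comp` is the same for every operator, so it can be read off from
the identity on ℂ, where it is a product of two integrals of positive functions. -/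
theorem logIntegral_ne_zero {γ : ℝ} (h0 : 0 < γ) (h1 : γ < 1) : logIntegral γ ≠ 0 := by
  have h := isRegAccretive_id
  have hr : ∀ μ : ℝ, 0 ≤ μ → ∀ f : ℂ, resH (ContinuousLinearMap.id ℂ ℂ)
      (ContinuousLinearMap.id ℂ ℂ) μ f = ((1 + μ)⁻¹ : ℝ) * f := by
    intro μ hμ f
    have hne : (1 + (μ : ℂ)) ≠ 0 := by
      rw [← Complex.ofReal_one, ← Complex.ofReal_add]
      exact Complex.ofReal_ne_zero.2 (by linarith)
    rw [resH_apply, ← h.resV_unique hμ (v := ((1 + μ)⁻¹ : ℝ) * f)]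
    · rfl
    · intro φ
      simp only [ContinuousLinearMap.id_apply, RCLike.inner_apply]
      push_cast
      field_simp
  have hb : ∀ β : ℝ, 0 < β → β < 1 → ∃ x : ℝ, 0 < x ∧ ∀ f : ℂ,
      balakrishnan (ContinuousLinearMap.id ℂ ℂ) (ContinuousLinearMap.id ℂ ℂ) β f = x * f := by
    intro β hβ0 hβ1
    refine ⟨∫ μ in Ioi (0 : ℝ), μ ^ (-β) * (1 + μ)⁻¹, ?_, fun f => ?_⟩
    · have hi : IntegrableOn (fun μ : ℝ => μ ^ (-β) * (1 + μ)⁻¹) (Ioi 0) := by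
        have := (h.integrableOn_balakrishnan hβ0 hβ1 1).norm
        refine this.congr ((ae_restrict_mem measurableSet_Ioi).mono fun μ hμ => ?_)
        have hμ' : 0 < μ := hμ
        simp only
        rw [norm_rpow_smul hμ', hr μ hμ'.le, mul_one, Complex.norm_real,
          Real.norm_of_nonneg (by positivity)]
      rw [setIntegral_pos_iff_support_of_nonneg_ae _ hi]
      · have : Ioi (0 : ℝ) ⊆ Function.support (fun μ : ℝ => μ ^ (-β) * (1 + μ)⁻¹) ∩ Ioi 0 :=
          fun μ hμ => ⟨by have hμ' : 0 < μ := hμ; exact ne_of_gt (by positivity), hμ⟩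
        refine lt_of_lt_of_le ?_ (measure_mono this)
        simp
      · exact (ae_restrict_mem measurableSet_Ioi).mono fun μ hμ => by
          have hμ' : 0 < μ := hμ
          show (0 : ℝ) ≤ _
          positivity
    · rw [← integral_complex_ofReal, ← integral_mul_const, balakrishnan]
      refine setIntegral_congr_fun measurableSet_Ioi fun μ hμ => ?_
      rw [hr μ (le_of_lt hμ), smul_eq_mul]
      push_cast
      ring
  obtain ⟨x, hx, hx'⟩ := hb (1 - γ) (by linarith) (by linarith)
  obtain ⟨y, hy, hy'⟩ := hb γ h0 h1
  have key := h.balakrishnan_comp (γ := 1 - γ) (by linarith) (by linarith) 1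
  rw [sub_sub_cancel, hy', hx'] at key
  intro hz
  rw [hz, zero_smul] at key
  have : (x : ℂ) ≠ 0 := Complex.ofReal_ne_zero.2 hx.ne'
  have : (y : ℂ) ≠ 0 := Complex.ofReal_ne_zero.2 hy.ne'
  simp_all

end PowerComposition

/-! ### Fractional powers as Balakrishnan integrals, and integration by parts. -/

section Comparison

open Filter Topology Set

variable {V H : Type*} [NormedAddCommGroup V] [InnerProductSpace ℂ V]
  [NormedAddCommGroup H] [InnerProductSpace ℂ H] [CompleteSpace V] [CompleteSpace H]

namespace IsRegAccretive

variable {j : V →L[ℂ] H} {a b : V → V → ℂ} {T S : V →L[ℂ] V} {c c' : ℝ}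

theorem negPow_eq (h : IsRegAccretive j a T c) {β : ℝ} (h0 : 0 < β) (h1 : β < 1) (f : H) :
    negPow j a β f
      = ((Real.sin (β * Real.pi) / Real.pi : ℝ) : ℂ) • balakrishnan j T β f := by
  rw [negPow, if_neg h0.ne', if_neg h1.ne, balakrishnan]
  congr 1
  refine setIntegral_congr_fun measurableSet_Ioi fun μ hμ => ?_
  rw [h.resolventOp_eq (le_of_lt hμ)]

/-- If `u` belongs to the domain of the power `β ∈ (0, 1)`, with image `w`, then `u` is, up to a
factor depending on `β` only, the Balakrishnan integral of `w`. -/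
theorem eq_smul_balakrishnan_of_isPow {β : ℝ} (h0 : 0 < β) (h1 : β < 1) :
    ∃ κ : ℂ, ∀ {V H : Type*} [NormedAddCommGroup V] [InnerProductSpace ℂ V]
      [NormedAddCommGroup H] [InnerProductSpace ℂ H] [CompleteSpace V] [CompleteSpace H]
      {j : V →L[ℂ] H} {a : V → V → ℂ} {T : V →L[ℂ] V} {c : ℝ}, IsRegAccretive j a T c →
      ∀ u w : H, IsPow j a β u w → u = κ • balakrishnan j T β w := by
  set σ : ℂ := ((Real.sin ((1 - β) * Real.pi) / Real.pi : ℝ) : ℂ) with hσ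
  have hσ0 : σ ≠ 0 := by
    refine Complex.ofReal_ne_zero.2 (ne_of_gt (div_pos ?_ Real.pi_pos))
    refine Real.sin_pos_of_pos_of_lt_pi (mul_pos (by linarith) Real.pi_pos) ?_
    nlinarith [Real.pi_pos]
  have hκ0 := logIntegral_ne_zero (γ := 1 - β) (by linarith) (by linarith)
  refine ⟨(σ * logIntegral (1 - β))⁻¹, ?_⟩
  intro V H _ _ _ _ _ _ j a T c h u w hu
  rw [IsPow, h.negPow_eq (by linarith) (by linarith), h.solOp_eq] at hu
  -- Applying the integral of exponent β to A^(β-1) u = A⁻¹ w leaves a multiple of A⁻¹ u on the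
  -- left. On the right A⁻¹ commutes past the integral, and its injectivity removes it from both
  -- sides.
  have e1 := congrArg (balakrishnan j T β) hu
  have hlin : ∀ (z : ℂ) (f : H), balakrishnan j T β (z • f) = z • balakrishnan j T β f := by
    intro z f
    rw [balakrishnan, balakrishnan, ← integral_smul]
    refine integral_congr_ae (ae_of_all _ fun μ => ?_)
    simp only
    rw [map_smul, smul_comm]
  rw [hlin, h.balakrishnan_comp h0 h1] at e1
  have e2 : balakrishnan j T β (resH j T 0 w) = resH j T 0 (balakrishnan j T β w) := by
    rw [h.map_balakrishnan h0 h1, balakrishnan]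
    refine setIntegral_congr_fun measurableSet_Ioi fun μ hμ => ?_
    rw [h.resH_comm (le_of_lt hμ) le_rfl]
  rw [e2, smul_smul, ← map_smul] at e1
  have e3 := h.resH_zero_injective e1
  rw [← e3, smul_smul, inv_mul_cancel₀ (mul_ne_zero hσ0 hκ0), one_smul]

/-- The decay rates μ^(-1/2) and μ^(-3/2) in V are the hypotheses of the integration by parts, with
e = 1/2. -/
theorem resH_bounds (h : IsRegAccretive j a T c) (f : H) : ∃ C : ℝ, 0 ≤ C ∧
    (∀ μ, 0 < μ → ‖resV j T μ f‖ ≤ C) ∧ (∀ μ, 0 < μ → ‖resV j T μ f‖ ≤ C * μ ^ (-(1 / 2) : ℝ)) ∧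
    (∀ μ, 0 < μ → ‖resV j T μ (resH j T μ f)‖ ≤ C) ∧
    (∀ μ, 0 < μ → ‖resV j T μ (resH j T μ f)‖ ≤ C * μ ^ (-(1 / 2 + 1) : ℝ)) := by
  have hc := h.pos
  have b1 : ∀ μ (g : H), 0 < μ → ‖resV j T μ g‖ ≤ (‖j‖ / c) * ‖g‖ := by
    intro μ g hμ
    rw [div_mul_eq_mul_div, le_div_iff₀ hc, mul_comm]
    exact h.norm_resV_le hμ.le g
  have b2 : ∀ μ (g : H), 0 < μ → ‖resV j T μ g‖ ≤ (√c)⁻¹ * μ ^ (-(1 / 2) : ℝ) * ‖g‖ := by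
    intro μ g hμ
    have h1 := h.norm_resV_sq_le hμ.le g
    have h2 : √c * √μ * ‖resV j T μ g‖ ≤ ‖g‖ := by
      refine le_of_sq_le_sq ?_ (norm_nonneg _)
      rw [mul_pow, mul_pow, Real.sq_sqrt hc.le, Real.sq_sqrt hμ.le]
      exact h1
    rw [Real.rpow_neg hμ.le, ← Real.sqrt_eq_rpow, ← mul_inv, inv_mul_eq_div,
      le_div_iff₀ (by positivity)]
    linarith
  obtain ⟨C, hC, hb, hb'⟩ := h.exists_resH_bound
  set D := ‖j‖ / c + (√c)⁻¹ with hD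
  have hD1 : ‖j‖ / c ≤ D := le_add_of_nonneg_right (by positivity)
  have hD2 : (√c)⁻¹ ≤ D := le_add_of_nonneg_left (by positivity)
  have hD0 : 0 ≤ D := by positivity
  have hfC : ‖f‖ ≤ C * ‖f‖ := le_mul_of_one_le_left (norm_nonneg _) hC
  refine ⟨D * (C * ‖f‖), by positivity, fun μ hμ => ?_, fun μ hμ => ?_, fun μ hμ => ?_,
    fun μ hμ => ?_⟩
  · exact (b1 μ f hμ).trans (by gcongr)
  · refine (b2 μ f hμ).trans ?_
    calc (√c)⁻¹ * μ ^ (-(1 / 2) : ℝ) * ‖f‖ ≤ D * μ ^ (-(1 / 2) : ℝ) * (C * ‖f‖) := by gcongr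
      _ = _ := by ring
  · refine (b1 μ _ hμ).trans ?_
    have := hb μ f hμ.le
    gcongr
  · refine (b2 μ _ hμ).trans ?_
    have := hb' μ f 1 hμ zero_le_one le_rfl
    calc (√c)⁻¹ * μ ^ (-(1 / 2) : ℝ) * ‖resH j T μ f‖
        ≤ D * μ ^ (-(1 / 2) : ℝ) * (C * μ ^ (-1 : ℝ) * ‖f‖) := by gcongr
      _ = _ := by
        rw [show (-(1 / 2 + 1) : ℝ) = -(1 / 2) + -1 by norm_num, Real.rpow_add hμ]
        ring

/-- The Balakrishnan integral of exponent `β > 1 / 2` converges in `V`. -/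
theorem integrableOn_balakrishnan_resV (h : IsRegAccretive j a T c) {β : ℝ} (h0 : 1 / 2 < β)
    (h1 : β < 1) (f : H) :
    IntegrableOn (fun μ : ℝ => ((μ ^ (-β) : ℝ) : ℂ) • resV j T μ f) (Ioi 0) := by
  obtain ⟨C, hC, b1, b2, -, -⟩ := h.resH_bounds f
  exact integrableOn_rpow_smul ((h.continuousOn_resV f).mono Ioi_subset_Ici_self)
    (by linarith) (by linarith) b1 b2

/-- The form of the Balakrishnan integral of exponent `1 - γ > 1 / 2`. -/
theorem form_integral_resV (h : IsRegAccretive j a T c) {γ : ℝ} (h0 : 0 < γ) (h1 : γ < 1 / 2)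
    (f : H) (θ : V) :
    (γ : ℂ) * ⟪θ, T (∫ μ in Ioi (0 : ℝ), ((μ ^ (-(1 - γ)) : ℝ) : ℂ) • resV j T μ f)⟫_ℂ
      = ∫ μ in Ioi (0 : ℝ), ((μ ^ γ : ℝ) : ℂ) • ⟪j θ, resPsi j T μ f⟫_ℂ := by
  obtain ⟨C, hC, b1, b2, b3, b4⟩ := h.resH_bounds f
  have hint := h.integrableOn_balakrishnan_resV (β := 1 - γ) (by linarith) (by linarith) f
  set L : V →L[ℂ] ℂ := (innerSL ℂ θ).comp T with hL
  have hLn : ∀ v, ‖L v‖ ≤ ‖L‖ * ‖v‖ := L.le_opNorm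
  have e1 : ⟪θ, T (∫ μ in Ioi (0 : ℝ), ((μ ^ (-(1 - γ)) : ℝ) : ℂ) • resV j T μ f)⟫_ℂ
      = ∫ μ in Ioi (0 : ℝ), ((μ ^ (-(1 - γ)) : ℝ) : ℂ) • L (resV j T μ f) := by
    have := ContinuousLinearMap.integral_comp_comm L hint
    simp only [map_smul] at this
    exact this.symm
  -- By the resolvent equation this function is (f, θ) - (μ R_μ f, θ), so differentiability of the
  -- resolvent in H suffices.
  have hder : ∀ μ, 0 < μ → HasDerivAt (fun μ => L (resV j T μ f)) (-⟪j θ, resPsi j T μ f⟫_ℂ) μ := by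
    intro μ hμ
    have k1 := ((innerSL ℂ (j θ)).restrictScalars ℝ).hasFDerivAt.comp_hasDerivAt μ
      (h.hasDerivAt_smul_resH hμ f)
    have k2 := k1.const_sub ⟪j θ, f⟫_ℂ
    refine k2.congr_of_eventuallyEq ?_
    filter_upwards [Ioi_mem_nhds hμ] with ν hν
    have := h.resV_spec (le_of_lt hν) f θ
    simp only [hL, ContinuousLinearMap.comp_apply, innerSL_apply_apply, Function.comp_apply,
      ContinuousLinearMap.coe_restrictScalars']
    rw [inner_smul_right, ← this]
    ring
  have hψ : ∀ μ, 0 < μ → -⟪j θ, resPsi j T μ f⟫_ℂ = -L (resV j T μ (resH j T μ f)) := by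
    intro μ hμ
    rw [h.inner_resPsi hμ.le]; rfl
  have hcont : ContinuousOn (fun μ => -⟪j θ, resPsi j T μ f⟫_ℂ) (Ioi 0) :=
    (continuousOn_const.inner ((h.continuousOn_resPsi f).mono Ioi_subset_Ici_self)).neg
  -- With e = 1/2 the condition 1 - b < e is exactly γ < 1/2.
  have key := integral_rpow_smul_by_parts (X := ℂ) (b := 1 - γ) (e := 1 / 2) (C := ‖L‖ * C) hder
    hcont (by linarith) (by linarith) (by linarith)
    (fun μ hμ => (hLn _).trans (by gcongr; exact b1 μ hμ))
    (fun μ hμ => (hLn _).trans (by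
      rw [mul_assoc]; gcongr; exact b2 μ hμ))
    (fun μ hμ => by
      rw [hψ μ hμ, norm_neg]; exact (hLn _).trans (by gcongr; exact b3 μ hμ))
    (fun μ hμ => by
      rw [hψ μ hμ, norm_neg, mul_assoc]; exact (hLn _).trans (by gcongr; exact b4 μ hμ))
  rw [sub_sub_cancel] at key
  rw [e1, ← smul_eq_mul, key, ← integral_neg]
  simp only [smul_neg, neg_neg]

/-- The Balakrishnan integral in terms of `A (μ + A)⁻²`. -/
theorem smul_balakrishnan_eq (h : IsRegAccretive j a T c) {γ : ℝ} (h0 : 0 < γ) (h1 : γ < 1)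
    (f : H) : IntegrableOn (fun ν : ℝ => ((ν ^ (-γ) : ℝ) : ℂ) • resPsi j T ν f) (Ioi 0) ∧
      (γ : ℂ) • balakrishnan j T γ f
        = ∫ ν in Ioi (0 : ℝ), ((ν ^ (-γ) : ℝ) : ℂ) • resPsi j T ν f := by
  obtain ⟨C, hC, hb, hb'⟩ := h.exists_resH_bound
  have hC0 : 0 ≤ C := zero_le_one.trans hC
  have hcont : ContinuousOn (fun μ => -resH j T μ (resH j T μ f)) (Ioi 0) :=
    (h.continuousOn_resH_comp continuousOn_id (h.continuousOn_resH_Ioi f)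
      fun x hx => le_of_lt hx).neg
  set D := max (C * ‖f‖) (C * (C * ‖f‖)) with hD
  have b1 : ∀ μ, 0 < μ → ‖resH j T μ f‖ ≤ D := fun μ hμ => (hb μ f hμ.le).trans (le_max_left _ _)
  have b2 : ∀ μ, 0 < μ → ‖resH j T μ f‖ ≤ D * μ ^ (-1 : ℝ) := fun μ hμ => by
    refine (hb' μ f 1 hμ zero_le_one le_rfl).trans ?_
    rw [mul_right_comm]
    gcongr
    exact le_max_left _ _
  have b3 : ∀ μ, 0 < μ → ‖-resH j T μ (resH j T μ f)‖ ≤ D := fun μ hμ => by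
    rw [norm_neg]
    refine (hb μ _ hμ.le).trans (le_trans ?_ (le_max_right _ _))
    gcongr
    exact hb μ f hμ.le
  have b4 : ∀ μ, 0 < μ → ‖-resH j T μ (resH j T μ f)‖ ≤ D * μ ^ (-(1 + 1) : ℝ) := fun μ hμ => by
    rw [norm_neg]
    refine (hb' μ _ 1 hμ zero_le_one le_rfl).trans ?_
    calc C * μ ^ (-1 : ℝ) * ‖resH j T μ f‖
        ≤ C * μ ^ (-1 : ℝ) * (C * μ ^ (-1 : ℝ) * ‖f‖) := by
          gcongr; exact hb' μ f 1 hμ zero_le_one le_rfl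
      _ = (C * (C * ‖f‖)) * μ ^ (-(1 + 1) : ℝ) := by
          rw [neg_add, Real.rpow_add hμ]; ring
      _ ≤ _ := by gcongr; exact le_max_right _ _
  have key := integral_rpow_smul_by_parts (b := γ) (e := 1) (C := D)
    (fun μ hμ => h.hasDerivAt_resH hμ f) hcont h0 h1 (by linarith) b1 b2 b3 b4
  have i1 := h.integrableOn_balakrishnan h0 h1 f
  have i2 : IntegrableOn (fun μ : ℝ => ((μ ^ (1 - γ) : ℝ) : ℂ) • -resH j T μ (resH j T μ f))
      (Ioi 0) := integrableOn_rpow_smul hcont (by linarith) (by linarith) b3 b4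
  -- Since ψ_ν = R_ν - ν R_ν², the integral of ν^(-γ) ψ_ν is 1 - (1 - γ) = γ times that of ν^(-γ)
  -- R_ν.
  have hsum : ∀ ν ∈ Ioi (0 : ℝ), ((ν ^ (-γ) : ℝ) : ℂ) • resH j T ν f
      + ((ν ^ (1 - γ) : ℝ) : ℂ) • -resH j T ν (resH j T ν f)
      = ((ν ^ (-γ) : ℝ) : ℂ) • resPsi j T ν f := by
    intro ν hν
    have hν' : 0 < ν := hν
    rw [resPsi, smul_sub, smul_smul, ← Complex.ofReal_mul, smul_neg, ← sub_eq_add_neg,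
      sub_eq_add_neg 1 γ, Real.rpow_add hν', Real.rpow_one, mul_comm]
  refine ⟨(i1.add i2).congr_fun hsum measurableSet_Ioi, ?_⟩
  rw [← setIntegral_congr_fun measurableSet_Ioi hsum, integral_add i1 i2, ← neg_neg
    (∫ μ in Ioi (0 : ℝ), ((μ ^ (1 - γ) : ℝ) : ℂ) • -resH j T μ (resH j T μ f)), ← key,
    ← balakrishnan, ← sub_eq_add_neg]
  push_cast
  rw [sub_smul, one_smul]
  abel

/-! ### The mixed kernel and the dual bound. -/

/-- The mixed kernel of two forms on the same space. -/
theorem norm_inner_resPsi_le (h : IsRegAccretive j a T c) (h' : IsRegAccretive j b S c') {μ ν : ℝ}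
    (hμ : 0 < μ) (hν : 0 < ν) (f g : H) :
    ‖⟪resPsi j S ν g, resPsi j T μ f⟫_ℂ‖ * μ ≤ (1 + ‖T‖ * (√c * √c')⁻¹)
      * (√(⟪f, resPsi j T μ f⟫_ℂ).re * √(⟪g, resPsi j S ν g⟫_ℂ).re) ∧
    ‖⟪resPsi j S ν g, resPsi j T μ f⟫_ℂ‖ * (√μ * √ν) ≤ (1 + ‖T‖ * (√c * √c')⁻¹)
      * (√(⟪f, resPsi j T μ f⟫_ℂ).re * √(⟪g, resPsi j S ν g⟫_ℂ).re) := by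
  have q1 := h.quadratic_density hμ.le f
  have q2 := h'.quadratic_density hν.le g
  have hc := h.pos
  have hc' := h'.pos
  set P := (⟪f, resPsi j T μ f⟫_ℂ).re
  set Q := (⟪g, resPsi j S ν g⟫_ℂ).re
  set w := resV j T μ (resH j T μ f) with hw
  set y := resV j S ν (g - (ν : ℂ) • resH j S ν g) with hy
  have hPQ : 0 ≤ √P * √Q := by positivity
  have hK : 0 ≤ ‖T‖ * (√c * √c')⁻¹ := by positivity
  constructor
  -- The pairing becomes a(w, y) with y ∈ V coming from the other form; the quadratic densities
  -- bound μ ‖w‖ and ‖y‖ in V.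
  · have e : ⟪resPsi j S ν g, resPsi j T μ f⟫_ℂ = ⟪y, T w⟫_ℂ := by
      rw [hw, ← h.inner_resPsi hμ.le, resPsi_eq j S ν g]; rfl
    have w1 : √c * (μ * ‖w‖) ≤ √P := by
      refine Real.le_sqrt_of_sq_le ?_
      rw [mul_pow, Real.sq_sqrt hc.le]
      have : 0 ≤ 2 * μ * ‖resPsi j T μ f‖ ^ 2
        + c * ‖resV j T μ (f - (μ : ℂ) • resH j T μ f)‖ ^ 2 := by positivity
      linarith
    have y1 : √c' * ‖y‖ ≤ √Q := by
      refine Real.le_sqrt_of_sq_le ?_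
      rw [mul_pow, Real.sq_sqrt hc'.le]
      have : 0 ≤ c' * (ν * ‖resV j S ν (resH j S ν g)‖) ^ 2 + 2 * ν * ‖resPsi j S ν g‖ ^ 2 := by
        positivity
      linarith
    have n1 : ‖⟪y, T w⟫_ℂ‖ ≤ ‖y‖ * (‖T‖ * ‖w‖) :=
      (norm_inner_le_norm _ _).trans (by gcongr; exact T.le_opNorm w)
    rw [e]
    calc ‖⟪y, T w⟫_ℂ‖ * μ ≤ ‖y‖ * (‖T‖ * ‖w‖) * μ := by gcongr
      _ = ‖T‖ * (√c * √c')⁻¹ * ((√c * (μ * ‖w‖)) * (√c' * ‖y‖)) := by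
        field_simp
      _ ≤ ‖T‖ * (√c * √c')⁻¹ * (√P * √Q) := by gcongr
      _ ≤ _ := by nlinarith
  -- The second bound is the Cauchy-Schwarz inequality in H, with the middle term of each quadratic
  -- density.
  · have w1 : √μ * ‖resPsi j T μ f‖ ≤ √P := by
      refine Real.le_sqrt_of_sq_le ?_
      rw [mul_pow, Real.sq_sqrt hμ.le]
      have : 0 ≤ c * (μ * ‖w‖) ^ 2 + μ * ‖resPsi j T μ f‖ ^ 2
        + c * ‖resV j T μ (f - (μ : ℂ) • resH j T μ f)‖ ^ 2 := by positivity
      linarith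
    have y1 : √ν * ‖resPsi j S ν g‖ ≤ √Q := by
      refine Real.le_sqrt_of_sq_le ?_
      rw [mul_pow, Real.sq_sqrt hν.le]
      have : 0 ≤ c' * (ν * ‖resV j S ν (resH j S ν g)‖) ^ 2 + ν * ‖resPsi j S ν g‖ ^ 2
        + c' * ‖y‖ ^ 2 := by positivity
      linarith
    calc ‖⟪resPsi j S ν g, resPsi j T μ f⟫_ℂ‖ * (√μ * √ν)
        ≤ (‖resPsi j S ν g‖ * ‖resPsi j T μ f‖) * (√μ * √ν) := by
          gcongr; exact norm_inner_le_norm _ _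
      _ = (√μ * ‖resPsi j T μ f‖) * (√ν * ‖resPsi j S ν g‖) := by ring
      _ ≤ √P * √Q := by gcongr
      _ ≤ _ := by nlinarith

/-- The bound of the form on the product of the two Balakrishnan integrals. -/
theorem norm_integral_resPsi_le (h : IsRegAccretive j a T c) (h' : IsRegAccretive j b S c') {γ : ℝ}
    (h0 : 0 < γ) (h1 : γ < 1 / 2) (f g : H) :
    ‖∫ μ in Ioi (0 : ℝ), ((μ ^ γ : ℝ) : ℂ) •
        ⟪(γ : ℂ) • balakrishnan j S γ g, resPsi j T μ f⟫_ℂ‖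
      ≤ 2 * (1 + ‖T‖ * (√c * √c')⁻¹) * (1 / (1 / 2 - γ) + 1 / γ) * (‖f‖ * ‖g‖) := by
  have hK : 0 ≤ 1 + ‖T‖ * (√c * √c')⁻¹ := by positivity
  have hγ' : 0 < 1 / 2 - γ := by linarith
  obtain ⟨hi, hrep⟩ := h'.smul_balakrishnan_eq h0 (by linarith) g
  have hkey := lintegral_kernel_le h0 h1 hK (norm_nonneg f) (norm_nonneg g)
    (P := fun μ => (⟪f, resPsi j T μ f⟫_ℂ).re) (Q := fun ν => (⟪g, resPsi j S ν g⟫_ℂ).re)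
    (N := fun μ ν => ‖⟪resPsi j S ν g, resPsi j T μ f⟫_ℂ‖)
    (Complex.continuous_re.comp_continuousOn
      (continuousOn_const.inner ((h.continuousOn_resPsi f).mono Ioi_subset_Ici_self)))
    (Complex.continuous_re.comp_continuousOn
      (continuousOn_const.inner ((h'.continuousOn_resPsi g).mono Ioi_subset_Ici_self)))
    (fun μ hμ => h.resPsi_re_nonneg hμ.le f) (fun μ hμ => h'.resPsi_re_nonneg hμ.le g)
    (h.lintegral_quadratic_le f) (h'.lintegral_quadratic_le g)
    (fun μ ν hμ hν => (h.norm_inner_resPsi_le h' hμ hν f g).1)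
    (fun μ ν hμ hν => (h.norm_inner_resPsi_le h' hμ hν f g).2)
  rw [← ENNReal.ofReal_le_ofReal_iff (by positivity), ofReal_norm]
  refine (enorm_integral_le_lintegral_enorm _).trans (le_trans ?_ hkey)
  refine setLIntegral_mono' measurableSet_Ioi fun μ hμ => ?_
  have hμ' : 0 < μ := hμ
  set x := resPsi j T μ f
  have e : ⟪(γ : ℂ) • balakrishnan j S γ g, x⟫_ℂ
      = starRingEnd ℂ (∫ ν in Ioi (0 : ℝ), ((ν ^ (-γ) : ℝ) : ℂ) • ⟪x, resPsi j S ν g⟫_ℂ) := by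
    have := ContinuousLinearMap.integral_comp_comm (innerSL ℂ x) hi
    simp only [map_smul, innerSL_apply_apply] at this
    rw [this, ← hrep, inner_conj_symm]
  rw [e, enorm_smul, RCLike.enorm_conj]
  refine (mul_le_mul_right (enorm_integral_le_lintegral_enorm _) _).trans ?_
  rw [← lintegral_const_mul' _ _ enorm_ne_top]
  refine setLIntegral_mono' measurableSet_Ioi fun ν hν => ?_
  have hν' : 0 < ν := hν
  rw [enorm_smul, ← mul_assoc, ← ofReal_norm, ← ofReal_norm, ← ofReal_norm, Complex.norm_real,
    Complex.norm_real, Real.norm_of_nonneg (by positivity), Real.norm_of_nonneg (by positivity),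
    norm_inner_symm, ← ENNReal.ofReal_mul (by positivity), ← ENNReal.ofReal_mul (by positivity)]

/-- The abstract regularity result: for two forms `a`, `b` on the same space and `0 ≤ γ < 1 / 2`,
an element `u` of the domain of the power `1 - γ` of the operator of `a` lies in `V`, and the
functional `a(u, ·)` is bounded in the norm of the domain of the power `γ` of the operator
of `b`. -/
theorem exists_bound_form (h : IsRegAccretive j a T c) (h' : IsRegAccretive j b S c') {γ : ℝ}
    (h0 : 0 ≤ γ) (h1 : γ < 1 / 2) : ∃ C : ℝ≥0, ∀ u w : H, IsPow j a (1 - γ) u w →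
      ∃ p : V, j p = u ∧ ∀ (θ : V) (ζ : H), IsPow j b γ (j θ) ζ → ‖a p θ‖ ≤ C * ‖w‖ * ‖ζ‖ := by
  rcases h0.eq_or_lt with h00 | h0
  · subst h00
    refine ⟨1, fun u w hu => ⟨resV j T 0 w, ?_, fun θ ζ hθ => ?_⟩⟩
    · rw [IsPow, sub_zero, sub_self, negPow, if_pos rfl, h.solOp_eq] at hu
      exact hu.symm
    · rw [IsPow, sub_zero, negPow, if_neg one_ne_zero, if_pos rfl, h'.solOp_eq, h'.solOp_eq] at hθ
      have hθ' : j θ = ζ := h'.resH_zero_injective hθ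
      have := h.resV_spec le_rfl w θ
      rw [Complex.ofReal_zero, zero_mul, add_zero] at this
      rw [h.repr, this, hθ', NNReal.coe_one, one_mul, mul_comm]
      exact norm_inner_le_norm _ _
  · obtain ⟨κ, hκ⟩ := eq_smul_balakrishnan_of_isPow (β := 1 - γ) (by linarith) (by linarith)
    obtain ⟨κ', hκ'⟩ := eq_smul_balakrishnan_of_isPow (β := γ) h0 (by linarith)
    set D := 2 * (1 + ‖T‖ * (√c * √c')⁻¹) * (1 / (1 / 2 - γ) + 1 / γ) with hD
    have hγ' : 0 < 1 / 2 - γ := by linarith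
    have hD0 : 0 ≤ D := by positivity
    have hγc : (γ : ℂ) ≠ 0 := Complex.ofReal_ne_zero.2 h0.ne'
    refine ⟨(‖κ‖ * γ⁻¹ * (‖κ'‖ * γ⁻¹) * D).toNNReal, fun u w hu => ?_⟩
    set p₀ := ∫ μ in Ioi (0 : ℝ), ((μ ^ (-(1 - γ)) : ℝ) : ℂ) • resV j T μ w with hp₀
    refine ⟨κ • p₀, ?_, fun θ ζ hθ => ?_⟩
    · rw [hκ h u w hu, map_smul, hp₀, balakrishnan, ← ContinuousLinearMap.integral_comp_comm j
        (h.integrableOn_balakrishnan_resV (by linarith) (by linarith) w)]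
      simp only [map_smul, resH_apply]
    · have e1 : j θ = (κ' * (γ : ℂ)⁻¹) • ((γ : ℂ) • balakrishnan j S γ ζ) := by
        rw [hκ' h' _ _ hθ, smul_smul, inv_mul_cancel_right₀ hγc]
      have e2 := h.form_integral_resV h0 h1 w θ
      have e3 : ∫ μ in Ioi (0 : ℝ), ((μ ^ γ : ℝ) : ℂ) • ⟪j θ, resPsi j T μ w⟫_ℂ
          = starRingEnd ℂ (κ' * (γ : ℂ)⁻¹) * ∫ μ in Ioi (0 : ℝ), ((μ ^ γ : ℝ) : ℂ) •
            ⟪(γ : ℂ) • balakrishnan j S γ ζ, resPsi j T μ w⟫_ℂ := by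
        rw [← integral_const_mul]
        refine integral_congr_ae (ae_of_all _ fun μ => ?_)
        simp only
        rw [e1, inner_smul_left, smul_eq_mul, smul_eq_mul]
        ring
      rw [e3] at e2
      have e4 : a (κ • p₀) θ = κ * ((γ : ℂ)⁻¹ * (starRingEnd ℂ (κ' * (γ : ℂ)⁻¹) *
          ∫ μ in Ioi (0 : ℝ), ((μ ^ γ : ℝ) : ℂ) •
            ⟪(γ : ℂ) • balakrishnan j S γ ζ, resPsi j T μ w⟫_ℂ)) := by
        rw [← e2, inv_mul_cancel_left₀ hγc, h.repr, map_smul, inner_smul_right]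
      have hb := h.norm_integral_resPsi_le h' h0 h1 w ζ
      rw [e4, norm_mul, norm_mul, norm_mul, RCLike.norm_conj, norm_mul, norm_inv,
        Complex.norm_real, Real.norm_of_nonneg h0.le, Real.coe_toNNReal _ (by positivity)]
      calc _ ≤ ‖κ‖ * (γ⁻¹ * (‖κ'‖ * γ⁻¹ * (D * (‖w‖ * ‖ζ‖)))) := by gcongr
        _ = _ := by ring

end IsRegAccretive

end Comparison

section AbstractForms

variable {V H : Type*} [NormedAddCommGroup V] [InnerProductSpace ℂ V]
  [NormedAddCommGroup H] [InnerProductSpace ℂ H] [CompleteSpace V]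

/-- A bounded coercive sesquilinear form is represented by a bounded operator. -/
theorem exists_isRegAccretive {j : V →L[ℂ] H} (hj : DenseRange j) {a : V → V → ℂ} {c c₁ : ℝ}
    (hc : 0 < c) (hadd : ∀ u u' v, a (u + u') v = a u v + a u' v)
    (hsmul : ∀ (z : ℂ) u v, a (z • u) v = z * a u v)
    (hadd' : ∀ u v v', a u (v + v') = a u v + a u v')
    (hsmul' : ∀ (z : ℂ) u v, a u (z • v) = starRingEnd ℂ z * a u v)
    (hcoer : ∀ v, c * ‖v‖ ^ 2 ≤ (a v v).re) (hbdd : ∀ u v, ‖a u v‖ ≤ c₁ * ‖u‖ * ‖v‖) :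
    ∃ T : V →L[ℂ] V, IsRegAccretive j a T c := by
  let B : V →ₗ⋆[ℂ] V →ₗ[ℂ] ℂ := LinearMap.mk₂'ₛₗ (starRingEnd ℂ) (RingHom.id ℂ)
    (fun u v => starRingEnd ℂ (a u v))
    (fun u u' v => by simp only [hadd, map_add])
    (fun z u v => by simp only [hsmul, map_mul, smul_eq_mul])
    (fun u v v' => by simp only [hadd', map_add])
    (fun z u v => by simp only [hsmul', map_mul, Complex.conj_conj, smul_eq_mul, RingHom.id_apply])
  have hB : ∀ u v, ‖B u v‖ ≤ c₁ * ‖u‖ * ‖v‖ := by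
    intro u v
    show ‖starRingEnd ℂ (a u v)‖ ≤ _
    rw [RCLike.norm_conj]
    exact hbdd u v
  let T := InnerProductSpace.continuousLinearMapOfBilin (B.mkContinuous₂ c₁ hB)
  have hT : ∀ u v, a u v = ⟪v, T u⟫_ℂ := by
    intro u v
    rw [← inner_conj_symm, InnerProductSpace.continuousLinearMapOfBilin_apply,
      LinearMap.mkContinuous₂_apply]
    exact (Complex.conj_conj _).symm
  exact ⟨T, hc, hT, fun v => hT v v ▸ hcoer v, hj⟩

theorem IsRegAccretive.adjForm {j : V →L[ℂ] H} {a : V → V → ℂ} {T : V →L[ℂ] V} {c : ℝ}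
    (h : IsRegAccretive j a T c) :
    IsRegAccretive j (adjForm a) (ContinuousLinearMap.adjoint T) c where
  pos := h.pos
  repr u v := by
    rw [RegAcc.adjForm, h.repr, ContinuousLinearMap.adjoint_inner_right, inner_conj_symm]
  coercive v := by
    rw [ContinuousLinearMap.adjoint_inner_right]
    exact (h.coercive v).trans_eq (inner_re_symm (𝕜 := ℂ) _ _)
  dense := h.dense

theorem IsRegAccretive.reForm {j : V →L[ℂ] H} {a : V → V → ℂ} {T : V →L[ℂ] V} {c : ℝ}
    (h : IsRegAccretive j a T c) :
    IsRegAccretive j (reForm a) ((1 / 2 : ℂ) • (T + ContinuousLinearMap.adjoint T)) c where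
  pos := h.pos
  repr u v := by
    rw [RegAcc.reForm, smul_apply, add_apply,
      inner_smul_right, inner_add_right, ← h.repr, ← h.adjForm.repr, RegAcc.adjForm]
    ring
  coercive v := by
    rw [smul_apply, add_apply, inner_smul_right,
      inner_add_right]
    have h1 := h.coercive v
    have h2 := h.adjForm.coercive v
    have h3 : ((1 / 2 : ℂ) * (⟪v, T v⟫_ℂ + ⟪v, ContinuousLinearMap.adjoint T v⟫_ℂ)).re
        = ((⟪v, T v⟫_ℂ).re + (⟪v, ContinuousLinearMap.adjoint T v⟫_ℂ).re) / 2 := by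
      rw [one_div, ← Complex.ofReal_ofNat, ← Complex.ofReal_inv, Complex.re_ofReal_mul,
        Complex.add_re]
      ring
    rw [h3]
    linarith
  dense := h.dense

end AbstractForms

section Concrete

open Filter Topology Set

variable {d : ℕ} {Ω ΓD : Set (E d)}

theorem exists_integral_smul_clm {η : E d → ℝ} (hη : Continuous η) (hc : HasCompactSupport η) :
    ∃ L : L2 Ω →L[ℂ] ℂ, ∀ u, L u = ∫ x in Ω, η x • u x := by
  have h1 : MemLp (fun x => (η x : ℂ)) 2 (volume.restrict Ω) :=
    (hη.memLp_of_hasCompactSupport hc).ofReal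
  refine ⟨innerSL ℂ (h1.toLp _), fun u => ?_⟩
  rw [innerSL_apply_apply, L2.inner_def]
  refine integral_congr_ae ?_
  filter_upwards [h1.coeFn_toLp] with x hx
  rw [hx, RCLike.inner_apply, Complex.conj_ofReal, Complex.real_smul, mul_comm]

theorem isClosed_VD : IsClosed (VD Ω ΓD : Set (L2Tuple Ω)) := by
  have h1 : IsClosed {p : L2Tuple Ω | p ∈ H1 Ω} := by
    have : {p : L2Tuple Ω | p ∈ H1 Ω} = ⋂ (i : Fin d) (φ : E d → ℝ) (_ : ContDiff ℝ ∞ φ)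
        (_ : HasCompactSupport φ) (_ : tsupport φ ⊆ Ω),
        {p | ∫ x in Ω, partialD i φ x • p 0 x = - ∫ x in Ω, φ x • p i.succ x} := by
      ext p
      simp only [mem_iInter]
      exact Iff.rfl
    rw [this]
    refine isClosed_iInter fun i => isClosed_iInter fun φ => isClosed_iInter fun h1 =>
      isClosed_iInter fun h2 => isClosed_iInter fun h3 => ?_
    obtain ⟨L, hL⟩ := exists_integral_smul_clm (Ω := Ω) (partialD_continuous h1 i)
      (partialD_compact h2 i)
    obtain ⟨L', hL'⟩ := exists_integral_smul_clm (Ω := Ω) h1.continuous h2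
    simp only [← hL, ← hL']
    refine isClosed_eq (L.continuous.comp ?_) (L'.continuous.comp ?_).neg
    · exact (PiLp.proj (𝕜 := ℂ) 2 (fun _ : Fin (d + 1) => L2 Ω) 0).continuous
    · exact (PiLp.proj (𝕜 := ℂ) 2 (fun _ : Fin (d + 1) => L2 Ω) i.succ).continuous
  have h2 : IsClosed {p : L2Tuple Ω | HasTrace Ω ΓD p 0} := by
    refine isClosed_of_closure_subset fun p hp ε hε => ?_
    obtain ⟨p', hp', hd⟩ := Metric.mem_closure_iff.1 hp (ε / 2) (half_pos hε)
    obtain ⟨ψ, q, hq, hpq, ht⟩ := hp' (ε / 2) (half_pos hε)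
    refine ⟨ψ, q, hq, ?_, ht.trans_le (ENNReal.ofReal_le_ofReal (by linarith))⟩
    calc ‖p - q‖ = ‖(p - p') + (p' - q)‖ := by congr 1; abel
      _ ≤ ‖p - p'‖ + ‖p' - q‖ := norm_add_le _ _
      _ < ε := by rw [dist_eq_norm] at hd; linarith
  exact h1.inter h2

instance completeSpace_VD : CompleteSpace (VD Ω ΓD) := isClosed_VD.completeSpace_coe

/-- Test functions on `Ω` belong to the variational space. -/
theorem exists_VD_of_test (hΓ : Disjoint ΓD Ω) {φ : E d → ℝ}
    (h1 : ContDiff ℝ ∞ φ) (h2 : HasCompactSupport φ) (h3 : tsupport φ ⊆ Ω) :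
    ∃ q : VD Ω ΓD, incl Ω ΓD q =ᵐ[volume.restrict Ω] fun x => (φ x : ℂ) := by
  set ψ : E d → ℂ := fun x => (φ x : ℂ) with hψ
  have s1 : ContDiff ℝ ∞ ψ := Complex.ofRealCLM.contDiff.comp h1
  have s2 : HasCompactSupport ψ := h2.comp_left (g := fun t : ℝ => (t : ℂ)) Complex.ofReal_zero
  have c1 : ∀ i, Continuous (partialD i ψ) := fun i =>
    (s1.continuous_fderiv (by simp)).clm_apply continuous_const
  have c2 : ∀ i, HasCompactSupport (partialD i ψ) := fun i => s2.fderiv_apply (𝕜 := ℝ) _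
  have m0 : MemLp ψ 2 (volume.restrict Ω) := s1.continuous.memLp_of_hasCompactSupport s2
  have m1 : ∀ i, MemLp (partialD i ψ) 2 (volume.restrict Ω) := fun i =>
    (c1 i).memLp_of_hasCompactSupport (c2 i)
  let q : L2Tuple Ω := WithLp.toLp 2
    (Fin.cons (m0.toLp ψ) fun i => (m1 i).toLp (partialD i ψ))
  have q0 : q 0 =ᵐ[volume.restrict Ω] ψ := m0.coeFn_toLp
  have q1 : ∀ i : Fin d, q i.succ =ᵐ[volume.restrict Ω] partialD i ψ := fun i =>
    (m1 i).coeFn_toLp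
  have hH1 : q ∈ H1 Ω := by
    intro i χ k1 k2 k3
    have z : ∀ x, x ∉ Ω → χ x = 0 ∧ partialD i χ x = 0 := by
      intro x hx
      have hx' : x ∉ tsupport χ := fun hh => hx (k3 hh)
      refine ⟨image_eq_zero_of_notMem_tsupport hx', ?_⟩
      rw [partialD, fderiv_of_notMem_tsupport (𝕜 := ℝ) hx']; rfl
    have e0 : ∫ x in Ω, partialD i χ x • q 0 x = ∫ x, partialD i χ x • ψ x := by
      refine (integral_congr_ae (g := fun x => partialD i χ x • ψ x) ?_).trans
        (setIntegral_eq_integral_of_forall_compl_eq_zero fun x hx => by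
          rw [(z x hx).2, zero_smul])
      filter_upwards [q0] with x hx
      rw [hx]
    have e1 : ∫ x in Ω, χ x • q i.succ x = ∫ x, χ x • partialD i ψ x := by
      refine (integral_congr_ae (g := fun x => χ x • partialD i ψ x) ?_).trans
        (setIntegral_eq_integral_of_forall_compl_eq_zero fun x hx => by
          rw [(z x hx).1, zero_smul])
      filter_upwards [q1 i] with x hx
      rw [hx]
    rw [e0, e1]
    have hχ := partialD_continuous k1 i
    have hχc := partialD_compact k2 i
    have := integral_smul_fderiv_eq_neg_fderiv_smul_of_integrable (μ := volume) (f := χ) (g := ψ)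
      (v := EuclideanSpace.single i (1 : ℝ))
      ((hχ.smul s1.continuous).integrable_of_hasCompactSupport hχc.smul_right)
      ((k1.continuous.smul (c1 i)).integrable_of_hasCompactSupport k2.smul_right)
      ((k1.continuous.smul s1.continuous).integrable_of_hasCompactSupport k2.smul_right)
      (fun x _ => (k1.differentiable (by simp)) x) (fun x _ => (s1.differentiable (by simp)) x)
    exact (neg_eq_iff_eq_neg.2 this).symm
  have htr : HasTrace Ω ΓD q 0 := by
    intro ε hε
    refine ⟨ψ, q, ⟨s1, q0, q1⟩, by simpa using hε, ?_⟩
    have hz : ψ - 0 =ᵐ[(Measure.hausdorffMeasure ((d : ℝ) - 1)).restrict ΓD] 0 := by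
      rw [sub_zero]
      have hm : MeasurableSet {x | ¬ ψ x = (0 : E d → ℂ) x} :=
        (isOpen_ne_fun s1.continuous continuous_const).measurableSet
      refine (ae_iff (p := fun x => ψ x = (0 : E d → ℂ) x)).2 ?_
      rw [Measure.restrict_apply hm]
      refine (congrArg _ ?_).trans measure_empty
      refine eq_empty_of_forall_notMem fun x hx => ?_
      refine hx.1 ?_
      have : φ x = 0 := image_eq_zero_of_notMem_tsupport fun hh =>
        disjoint_left.1 hΓ hx.2 (h3 hh)
      simp [hψ, this]
    rw [eLpNorm_congr_ae hz]
    simpa using hε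
  exact ⟨⟨q, hH1, htr⟩, q0⟩

theorem denseRange_incl (hΩ : IsOpen Ω) (hΓ : Disjoint ΓD Ω) : DenseRange (incl Ω ΓD) := by
  have : (incl Ω ΓD).range.topologicalClosure = ⊤ := by
    rw [Submodule.topologicalClosure_eq_top_iff, Submodule.eq_bot_iff]
    intro f hf
    have hz : ∀ᵐ x ∂(volume.restrict Ω), x ∈ Ω → f x = 0 := by
      refine hΩ.ae_eq_zero_of_integral_contDiff_smul_eq_zero ?_ fun φ h1 h2 h3 => ?_
      · exact ((Lp.memLp f).locallyIntegrable (by norm_num)).locallyIntegrableOn Ω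
      · obtain ⟨q, hq⟩ := exists_VD_of_test hΓ h1 h2 h3
        have h0 : ⟪incl Ω ΓD q, f⟫_ℂ = 0 := hf _ ⟨q, rfl⟩
        rw [L2.inner_def] at h0
        rw [← h0]
        refine integral_congr_ae ?_
        filter_upwards [hq] with x hx
        rw [hx, RCLike.inner_apply, Complex.conj_ofReal, Complex.real_smul, mul_comm]
    refine (Lp.eq_zero_iff_ae_eq_zero).2 ?_
    filter_upwards [hz, ae_restrict_mem hΩ.measurableSet] with x hx hm
    exact hx hm
  intro x
  have hx : x ∈ (incl Ω ΓD).range.topologicalClosure := this ▸ Submodule.mem_top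
  exact hx

theorem formIntegrand_add_left (a : Fin (d + 1) → Fin (d + 1) → E d → ℂ) (u u' v : L2Tuple Ω) :
    formIntegrand a (u + u') v =ᵐ[volume.restrict Ω]
      fun x => formIntegrand a u v x + formIntegrand a u' v x := by
  filter_upwards [ae_all_iff.2 fun i => Lp.coeFn_add (u i) (u' i)] with x hx
  simp only [formIntegrand, PiLp.add_apply, hx, Pi.add_apply, mul_add, add_mul,
    Finset.sum_add_distrib]
  ring

theorem formIntegrand_smul_left (a : Fin (d + 1) → Fin (d + 1) → E d → ℂ) (z : ℂ)
    (u v : L2Tuple Ω) : formIntegrand a (z • u) v =ᵐ[volume.restrict Ω]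
      fun x => z * formIntegrand a u v x := by
  filter_upwards [ae_all_iff.2 fun i => Lp.coeFn_smul z (u i)] with x hx
  simp only [formIntegrand, PiLp.smul_apply, hx, Pi.smul_apply, smul_eq_mul, mul_add,
    Finset.mul_sum]
  refine congrArg₂ (· + ·) (congrArg₂ (· + ·) ?_ ?_) ?_
  · exact Finset.sum_congr rfl fun i _ => Finset.sum_congr rfl fun k _ => by ring
  · exact Finset.sum_congr rfl fun i _ => by ring
  · ring

theorem formIntegrand_add_right (a : Fin (d + 1) → Fin (d + 1) → E d → ℂ) (u v v' : L2Tuple Ω) :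
    formIntegrand a u (v + v') =ᵐ[volume.restrict Ω]
      fun x => formIntegrand a u v x + formIntegrand a u v' x := by
  filter_upwards [ae_all_iff.2 fun i => Lp.coeFn_add (v i) (v' i)] with x hx
  simp only [formIntegrand, PiLp.add_apply, hx, Pi.add_apply, map_add, mul_add,
    Finset.sum_add_distrib]
  ring

theorem formIntegrand_smul_right (a : Fin (d + 1) → Fin (d + 1) → E d → ℂ) (z : ℂ)
    (u v : L2Tuple Ω) : formIntegrand a u (z • v) =ᵐ[volume.restrict Ω]
      fun x => starRingEnd ℂ z * formIntegrand a u v x := by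
  filter_upwards [ae_all_iff.2 fun i => Lp.coeFn_smul z (v i)] with x hx
  simp only [formIntegrand, PiLp.smul_apply, hx, Pi.smul_apply, smul_eq_mul, map_mul, mul_add,
    Finset.mul_sum]
  refine congrArg₂ (· + ·) (congrArg₂ (· + ·) ?_ ?_) ?_
  · exact Finset.sum_congr rfl fun i _ => Finset.sum_congr rfl fun k _ => by ring
  · exact Finset.sum_congr rfl fun i _ => by ring
  · ring

theorem exists_isRegAccretive_sesqForm (hΩ : IsOpen Ω) (hΓ : Disjoint ΓD Ω)
    {a : Fin (d + 1) → Fin (d + 1) → E d → ℂ}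
    (hint : ∀ u v : VD Ω ΓD, IntegrableOn (formIntegrand a (u : L2Tuple Ω) (v : L2Tuple Ω)) Ω)
    {c₀ c₁ : ℝ} (hc₀ : 0 < c₀)
    (hcoer : ∀ v : VD Ω ΓD, c₀ * ‖v‖ ^ 2 ≤ (sesqForm Ω ΓD a v v).re)
    (hbdd : ∀ u v : VD Ω ΓD, ‖sesqForm Ω ΓD a u v‖ ≤ c₁ * ‖u‖ * ‖v‖) :
    ∃ T : VD Ω ΓD →L[ℂ] VD Ω ΓD, IsRegAccretive (incl Ω ΓD) (sesqForm Ω ΓD a) T c₀ := by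
  refine exists_isRegAccretive (denseRange_incl hΩ hΓ) hc₀ (fun u u' v => ?_) (fun z u v => ?_)
    (fun u v v' => ?_) (fun z u v => ?_) hcoer hbdd
  · rw [sesqForm, Submodule.coe_add, integral_congr_ae (formIntegrand_add_left a _ _ _),
      integral_add (hint u v) (hint u' v), sesqForm, sesqForm]
  · rw [sesqForm, Submodule.coe_smul, integral_congr_ae (formIntegrand_smul_left a _ _ _),
      integral_const_mul, sesqForm]
  · rw [sesqForm, Submodule.coe_add, integral_congr_ae (formIntegrand_add_right a _ _ _),
      integral_add (hint u v) (hint u v'), sesqForm, sesqForm]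
  · rw [sesqForm, Submodule.coe_smul, integral_congr_ae (formIntegrand_smul_right a _ _ _),
      integral_const_mul, sesqForm]

/-- A regularity estimate for the elements of `V` whose functional is bounded in the dual norm
gives the embedding of the domain of the power `s / 2`. -/
theorem powDomainEmbeds_of_regularity {b e : VD Ω ΓD → VD Ω ΓD → ℂ}
    {T S : VD Ω ΓD →L[ℂ] VD Ω ΓD} {c c' : ℝ} (h : IsRegAccretive (incl Ω ΓD) b T c)
    (h' : IsRegAccretive (incl Ω ΓD) e S c') {s : ℝ} (hs₁ : 1 < s) (hs₂ : s ≤ 2) {C : ℝ≥0}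
    (hreg : ∀ (p : VD Ω ΓD) (M : ℝ≥0),
      (∀ (θ : VD Ω ΓD) (w : L2 Ω), IsPow (incl Ω ΓD) e ((1 - (s - 1)) / 2) (incl Ω ΓD θ) w →
        ‖b p θ‖ ≤ M * ‖w‖) →
      sobolevENorm s (p : L2Tuple Ω) ≤ C * M) : PowDomainEmbeds Ω ΓD b s := by
  obtain ⟨C', hC'⟩ := h.exists_bound_form h' (γ := 1 - s / 2) (by linarith) (by linarith)
  refine ⟨C * C', fun u w hu => ?_⟩
  rw [sub_sub_cancel] at hC'
  obtain ⟨p, hp, hb⟩ := hC' u w hu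
  refine ⟨p, hp, (hreg p (C' * ‖w‖₊) fun θ z hz => ?_).trans (le_of_eq ?_)⟩
  · rw [show (1 - (s - 1)) / 2 = 1 - s / 2 by ring] at hz
    simpa using hb θ z hz
  · rw [ENNReal.coe_mul, ENNReal.coe_mul, mul_assoc]; rfl

end Concrete

end RegAcc

end

theorem theorem4p2 {d : ℕ} (hd : 1 ≤ d) (Ω ΓN ΓD : Set (RegAcc.E d))
    (hΩopen : IsOpen Ω) (hΩconn : IsConnected Ω) (hΩbdd : Bornology.IsBounded Ω)
    (hΩlip : RegAcc.HasLipschitzBoundary Ω)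
    (hΓN : ∃ U : Set (RegAcc.E d), IsOpen U ∧ ΓN = frontier Ω ∩ U)
    (hΓD : ΓD = frontier Ω \ ΓN)
    (a : Fin (d + 1) → Fin (d + 1) → RegAcc.E d → ℂ)
    (hint : ∀ u v : RegAcc.VD Ω ΓD,
      MeasureTheory.IntegrableOn
        (RegAcc.formIntegrand a (u : RegAcc.L2Tuple Ω) (v : RegAcc.L2Tuple Ω)) Ω)
    (c₀ c₁ : ℝ) (hc₀ : 0 < c₀) (hc₁ : 0 < c₁)
    (hcoer : ∀ v : RegAcc.VD Ω ΓD, c₀ * ‖v‖ ^ 2 ≤ (RegAcc.sesqForm Ω ΓD a v v).re)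
    (hbdd : ∀ u v : RegAcc.VD Ω ΓD, ‖RegAcc.sesqForm Ω ΓD a u v‖ ≤ c₁ * ‖u‖ * ‖v‖)
    (α : ℝ) (hα₀ : 0 < α) (hα₁ : α ≤ 1)
    (hreg : RegAcc.EllipticRegularity Ω ΓD (RegAcc.sesqForm Ω ΓD a) α)
    (s : ℝ) (hs₁ : 1 < s) (hs₂ : s ≤ 1 + α) :
    RegAcc.PowDomainEmbeds Ω ΓD (RegAcc.sesqForm Ω ΓD a) s ∧
      RegAcc.PowDomainEmbeds Ω ΓD (RegAcc.adjForm (RegAcc.sesqForm Ω ΓD a)) s := by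
  have hdisj : Disjoint ΓD Ω := by
    rw [hΓD]
    refine Set.disjoint_left.2 fun x hx hxΩ => ?_
    have hx' : x ∈ Ω ∩ frontier Ω := ⟨hxΩ, hx.1⟩
    rwa [hΩopen.inter_frontier_eq] at hx'
  obtain ⟨T, h⟩ := RegAcc.exists_isRegAccretive_sesqForm hΩopen hdisj hint hc₀ hcoer hbdd
  obtain ⟨⟨C, hC⟩, ⟨C', hC'⟩⟩ := hreg (s - 1) (by linarith) (by linarith)
  rw [add_sub_cancel] at hC hC'
  refine ⟨RegAcc.powDomainEmbeds_of_regularity h h.reForm hs₁ (by linarith) (C := C)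
    fun p M hM => ?_,
    RegAcc.powDomainEmbeds_of_regularity h.adjForm h.reForm hs₁ (by linarith) (C := C')
    fun p M hM => ?_⟩
  · have hF : ⇑(innerSLFlip ℂ (T p)) = RegAcc.sesqForm Ω ΓD a p := by
      funext φ
      rw [h.repr]; rfl
    have := hC (innerSLFlip ℂ (T p)) M (by rw [hF]; exact hM)
    rwa [hF, h.solveForm_eq] at this
  · have hF : ⇑(innerSL ℂ (ContinuousLinearMap.adjoint T p))
        = fun φ => RegAcc.sesqForm Ω ΓD a φ p := by
      funext φ
      rw [h.repr, innerSL_apply_apply, ContinuousLinearMap.adjoint_inner_left]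
    have hs : RegAcc.solveFormAdj (RegAcc.sesqForm Ω ΓD a)
        (fun φ => RegAcc.sesqForm Ω ΓD a φ p) = p := by
      refine h.adjForm.eq_of_form_eq fun φ => congrArg (starRingEnd ℂ) ?_
      exact Classical.epsilon_spec (p := fun q : RegAcc.VD Ω ΓD => ∀ φ,
        RegAcc.sesqForm Ω ΓD a φ q = RegAcc.sesqForm Ω ΓD a φ p) ⟨p, fun _ => rfl⟩ φ
    have := hC' (innerSL ℂ (ContinuousLinearMap.adjoint T p)) M (by
      rw [hF]
      intro θ w hw
      rw [← RCLike.norm_conj]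
      exact hM θ w hw)
    rwa [hF, hs] at this
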